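/- Let $\Delta$ be a fan in $N_{\mathbb R}=\mathbb R^n$, i.e. a finite nonempty set of strongly convex rational polyhedral cones that contains every face of each of its members and in which the intersection of two members is a face of each. Let $X=X(\Delta)$ be the associated toric variety over $\mathbb C$, glued from the affine charts $U_\sigma=\operatorname{Spec}\mathbb C[\sigma^\vee\cap M]$, $\sigma\in\Delta$, where $M=\mathbb Z^n$ is the character lattice, and let $\mathbb T=(\mathbb C^*)^n\subset X$ be its torus. For $\sigma\in\Delta$ let $O_\sigma\subset X$ be the $\mathbb T$-orbit of the distinguished point of $U_\sigma$; it is itself an algebraic torus, $O_\sigma=\operatorname{Spec}\mathbb C[\sigma^\perp\cap M]$, with the distinguished point as unit. Let $A=(a_{ij})$ be an $n\times n$ integer matrix and let $\varphi=\varphi_A:X\dashrightarrow X$ be the monomial rational map that extends the endomorphism $(x_1,\dots,x_n)\mapsto(\prod_j x_j^{a_{1j}},\dots,\prod_j x_j^{a_{nj}})$ of $\mathbb T$. Let $X_\varphi$ be the set of points $P\in X$ whose forward orbit $P,\varphi(P),\varphi^2(P),\dots$ is well-defined (each term is a point at which the rational map $\varphi$ is defined), and let $$\operatorname{PrePer}(\varphi)=\{P\in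 X_\varphi : \varphi^r(P)=\varphi^s(P)\text{ for some } r>s\ge 0\}.$$ For a subgroup $G$ of a torus, write $G^{\mathrm{div}}=\{P : P^k\in G\text{ for some }k\ge 1\}$ for its divisible hull. Then $X_\varphi$ is also a toric variety: there is a fan $\Delta'\subseteq\Delta$ such that $X_\varphi=\bigsqcup_{\sigma\in\Delta'}O_\sigma$ (a disjoint union). Moreover, for each $\sigma\in\Delta'$ there is an algebraic (that is, Zariski closed) subgroup $G_\sigma$ of the torus $O_\sigma$ such that $$\operatorname{PrePer}(\varphi)\cap O_\sigma=G_\sigma^{\mathrm{div}},$$ and hence $\operatorname{PrePer}(\varphi)=\bigsqcup_{\sigma\in\Delta'}G_\sigma^{\mathrm{div}}$. -/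

import Mathlib

/-!  Toric varieties over the complex numbers attached to fans, their torus orbits, and the
dynamics of monomial rational self-maps.  The lattice of one-parameter subgroups is `N = ℤⁿ`, the
character lattice is `M = ℤⁿ`, and they are paired by the dot product. -/

noncomputable section

namespace Toric

/-- The algebraic torus `𝕋 = (ℂ*)ⁿ`. -/
abbrev Torus (n : ℕ) : Type := Fin n → ℂˣ

/-- The value at `t` of the character `χᵐ`, i.e. `t₁^{m₁} ⋯ tₙ^{mₙ}`, as a homomorphism in `m`. -/
def character {n : ℕ} (t : Torus n) : Multiplicative (Fin n → ℤ) →* ℂˣ where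
  toFun m := ∏ i, t i ^ (m.toAdd i)
  map_one' := by simp
  map_mul' a b := by simp [zpow_add, Finset.prod_mul_distrib]

/-- The monomial map `φ_A : 𝕋 → 𝕋`, whose `i`-th coordinate is `∏ⱼ tⱼ ^ aᵢⱼ`. -/
def monomialMap {n : ℕ} (A : Matrix (Fin n) (Fin n) ℤ) (t : Torus n) : Torus n :=
  fun i => ∏ j, t j ^ (A i j)

/-- The pairing of a character `m ∈ M` with a vector of `N_ℝ = ℝⁿ`. -/
def pairing {n : ℕ} (m : Fin n → ℤ) (v : Fin n → ℝ) : ℝ := ∑ i, (m i : ℝ) * v i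

lemma pairing_zero {n : ℕ} (v : Fin n → ℝ) : pairing 0 v = 0 := by simp [pairing]

lemma pairing_add {n : ℕ} (a b : Fin n → ℤ) (v : Fin n → ℝ) :
    pairing (a + b) v = pairing a v + pairing b v := by
  simp [pairing, add_mul, Finset.sum_add_distrib]

lemma pairing_neg {n : ℕ} (a : Fin n → ℤ) (v : Fin n → ℝ) : pairing (-a) v = -pairing a v := by
  simp [pairing]

/-! ### Cones and fans -/

/-- Convex cones (with apex `0`) in `N_ℝ = ℝⁿ`. -/
abbrev Cone (n : ℕ) : Type := PointedCone ℝ (Fin n → ℝ)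

/-- Rational polyhedral: generated by finitely many lattice vectors. -/
def IsRationalPolyhedral {n : ℕ} (σ : Cone n) : Prop :=
  ∃ S : Finset (Fin n → ℤ), σ = PointedCone.hull ℝ ((fun v i => (v i : ℝ)) '' (S : Set (Fin n → ℤ)))

/-- Strongly convex: the cone contains no line. -/
def IsStronglyConvex {n : ℕ} (σ : Cone n) : Prop := ∀ v ∈ σ, -v ∈ σ → v = 0

/-- `τ` is a face of `σ`: `τ = σ ∩ u^⊥` for some linear form `u` that is nonnegative on `σ`. -/
def IsFace {n : ℕ} (τ σ : Cone n) : Prop :=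
  ∃ u : Fin n → ℝ, (∀ v ∈ σ, 0 ≤ u ⬝ᵥ v) ∧ ∀ v, v ∈ τ ↔ v ∈ σ ∧ u ⬝ᵥ v = 0

/-- A (finite) fan in `N_ℝ = ℝⁿ`.  The zero cone is a face of every strongly convex cone, so that
`zero_mem` only says that the fan is not empty. -/
structure Fan (n : ℕ) where
  cones : Set (Cone n)
  finite : cones.Finite
  rational : ∀ σ ∈ cones, IsRationalPolyhedral σ
  stronglyConvex : ∀ σ ∈ cones, IsStronglyConvex σ
  zero_mem : ⊥ ∈ cones
  face_mem : ∀ σ ∈ cones, ∀ τ, IsFace τ σ → τ ∈ cones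
  inter_face : ∀ σ ∈ cones, ∀ σ' ∈ cones, IsFace (σ ⊓ σ') σ ∧ IsFace (σ ⊓ σ') σ'

/-- The monoid `σ^∨ ∩ M`. -/
def dualMonoid {n : ℕ} (σ : Cone n) : AddSubmonoid (Fin n → ℤ) where
  carrier := {m | ∀ v ∈ σ, 0 ≤ pairing m v}
  zero_mem' v _ := by rw [pairing_zero]
  add_mem' ha hb v hv := by rw [pairing_add]; exact add_nonneg (ha v hv) (hb v hv)

/-- The lattice `M(σ) = σ^⊥ ∩ M`. -/
def perpLattice {n : ℕ} (σ : Cone n) : AddSubgroup (Fin n → ℤ) where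
  carrier := {m | ∀ v ∈ σ, pairing m v = 0}
  zero_mem' v _ := pairing_zero v
  add_mem' ha hb v hv := by rw [pairing_add, ha v hv, hb v hv, add_zero]
  neg_mem' ha v hv := by rw [pairing_neg, ha v hv, neg_zero]

lemma dualMonoid_anti {n : ℕ} {τ σ : Cone n} (h : τ ≤ σ) : dualMonoid σ ≤ dualMonoid τ :=
  fun _ hm v hv => hm v (h hv)

lemma add_mem_perp_iff {n : ℕ} {σ : Cone n} {a b : Fin n → ℤ} (ha : a ∈ dualMonoid σ)
    (hb : b ∈ dualMonoid σ) :
    a + b ∈ perpLattice σ ↔ a ∈ perpLattice σ ∧ b ∈ perpLattice σ := by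
  refine ⟨fun h => ⟨fun v hv => ?_, fun v hv => ?_⟩, fun h => add_mem h.1 h.2⟩ <;>
  · have h1 := h v hv
    rw [pairing_add] at h1
    have h2 := ha v hv
    have h3 := hb v hv
    linarith

/-! ### The affine toric varieties `U_σ` -/

/-- The coordinate ring `ℂ[σ^∨ ∩ M]` of `U_σ`. -/
abbrev CoordRing {n : ℕ} (σ : Cone n) : Type := AddMonoidAlgebra ℂ (dualMonoid σ)

/-- The (closed) points of `U_σ = Spec ℂ[σ^∨ ∩ M]`. -/
abbrev Chart {n : ℕ} (σ : Cone n) : Type := CoordRing σ →ₐ[ℂ] ℂ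

lemma chart_ext {n : ℕ} {σ : Cone n} {x y : Chart σ}
    (h : ∀ m : dualMonoid σ, x (AddMonoidAlgebra.single m 1) = y (AddMonoidAlgebra.single m 1)) :
    x = y :=
  (AddMonoidAlgebra.lift ℂ ℂ (dualMonoid σ)).symm.injective
    (MonoidHom.ext fun m => by
      rw [AddMonoidAlgebra.lift_symm_apply, AddMonoidAlgebra.lift_symm_apply]; exact h m.toAdd)

/-- For `τ ⊆ σ`, the map `U_τ → U_σ` given by `ℂ[σ^∨ ∩ M] ⊆ ℂ[τ^∨ ∩ M]`. -/
def chartMap {n : ℕ} {τ σ : Cone n} (h : τ ≤ σ) (x : Chart τ) : Chart σ :=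
  x.comp (AddMonoidAlgebra.mapDomainAlgHom ℂ ℂ (AddSubmonoid.inclusion (dualMonoid_anti h)))

/-- The point of `U_σ` given by a point of the torus: it sends `χᵐ` to `χᵐ(t)`. -/
def torusChart {n : ℕ} (σ : Cone n) (t : Torus n) : Chart σ :=
  AddMonoidAlgebra.lift ℂ ℂ (dualMonoid σ)
    ((Units.coeHom ℂ).comp ((character t).comp (AddMonoidHom.toMultiplicative (dualMonoid σ).subtype)))

/-- The torus action on `U_σ`: `(t • x)(χᵐ) = χᵐ(t) x(χᵐ)`. -/
def actChart {n : ℕ} (σ : Cone n) (t : Torus n) (x : Chart σ) : Chart σ :=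
  AddMonoidAlgebra.lift ℂ ℂ (dualMonoid σ)
    ((AddMonoidAlgebra.lift ℂ ℂ (dualMonoid σ)).symm (torusChart σ t) *
      (AddMonoidAlgebra.lift ℂ ℂ (dualMonoid σ)).symm x)

lemma actChart_single {n : ℕ} (σ : Cone n) (t : Torus n) (x : Chart σ) (m : dualMonoid σ) :
    actChart σ t x (AddMonoidAlgebra.single m 1) =
      (character t (Multiplicative.ofAdd (m : Fin n → ℤ)) : ℂ) *
        x (AddMonoidAlgebra.single m 1) := by
  simp [actChart, torusChart]

lemma actChart_chartMap {n : ℕ} {τ σ : Cone n} (h : τ ≤ σ) (t : Torus n) (x : Chart τ) :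
    chartMap h (actChart τ t x) = actChart σ t (chartMap h x) := by
  apply chart_ext
  intro m
  rw [actChart_single]
  simp [chartMap, actChart_single]

/-- The torus `Hom(M(σ), ℂ*)` with coordinate ring `ℂ[σ^⊥ ∩ M]`. -/
abbrev OrbitTorus {n : ℕ} (σ : Cone n) : Type := Multiplicative (perpLattice σ) →* ℂˣ

open Classical in
/-- The inclusion `Spec ℂ[σ^⊥ ∩ M] ⊆ U_σ`: the point of `U_σ` that extends `x` by zero. -/
def orbitChart {n : ℕ} (σ : Cone n) (x : OrbitTorus σ) : Chart σ :=
  AddMonoidAlgebra.lift ℂ ℂ (dualMonoid σ)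
    { toFun := fun m =>
        if h : (m.toAdd : Fin n → ℤ) ∈ perpLattice σ then
          (x (Multiplicative.ofAdd ⟨(m.toAdd : Fin n → ℤ), h⟩) : ℂ) else 0
      map_one' := by
        have h0 : ((0 : dualMonoid σ) : Fin n → ℤ) ∈ perpLattice σ := (perpLattice σ).zero_mem
        have h1 : Multiplicative.ofAdd (⟨((0 : dualMonoid σ) : Fin n → ℤ), h0⟩ : perpLattice σ) = 1 :=
          rfl
        rw [toAdd_one, dif_pos h0, h1, map_one, Units.val_one]
      map_mul' := by
        intro a b
        have key := add_mem_perp_iff (σ := σ) a.toAdd.2 b.toAdd.2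
        by_cases ha : (a.toAdd : Fin n → ℤ) ∈ perpLattice σ
        · by_cases hb : (b.toAdd : Fin n → ℤ) ∈ perpLattice σ
          · have hab : ((a * b).toAdd : Fin n → ℤ) ∈ perpLattice σ := key.2 ⟨ha, hb⟩
            rw [dif_pos ha, dif_pos hb, dif_pos hab, ← Units.val_mul, ← map_mul]
            rfl
          · have hab : ((a * b).toAdd : Fin n → ℤ) ∉ perpLattice σ := fun h => hb (key.1 h).2
            rw [dif_neg hb, dif_neg hab, mul_zero]
        · have hab : ((a * b).toAdd : Fin n → ℤ) ∉ perpLattice σ := fun h => ha (key.1 h).1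
          rw [dif_neg ha, dif_neg hab, zero_mul] }

open Classical in
lemma orbitChart_single {n : ℕ} (σ : Cone n) (x : OrbitTorus σ) (m : dualMonoid σ) :
    orbitChart σ x (AddMonoidAlgebra.single m 1) =
      if h : (m : Fin n → ℤ) ∈ perpLattice σ then
        (x (Multiplicative.ofAdd ⟨(m : Fin n → ℤ), h⟩) : ℂ) else 0 := by
  simp [orbitChart]

/-- The distinguished point `P_σ ∈ U_σ`: it sends `χᵐ` to `1` if `m ∈ σ^⊥`, and to `0` otherwise. -/
def distinguishedChart {n : ℕ} (σ : Cone n) : Chart σ := orbitChart σ 1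

/-! ### The toric variety `X(Δ)` -/

/-- The gluing of the charts: `x ∈ U_σ` and `x' ∈ U_σ'` are identified if they come from the same
point of `U_{σ ∩ σ'}`. -/
def gluing {n : ℕ} (Δ : Fan n) (p q : Σ σ : Δ.cones, Chart σ.1) : Prop :=
  ∃ y : Chart (p.1.1 ⊓ q.1.1), chartMap inf_le_left y = p.2 ∧ chartMap inf_le_right y = q.2

/-- The set of complex points of the toric variety `X(Δ)`. -/
def Variety {n : ℕ} (Δ : Fan n) : Type := Quot (gluing Δ)

/-- The chart `U_σ → X(Δ)`. -/
def toVariety {n : ℕ} {Δ : Fan n} (σ : Δ.cones) (x : Chart σ.1) : Variety Δ :=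
  Quot.mk _ ⟨σ, x⟩

/-- The torus `𝕋 = U_{0} → X(Δ)`. -/
def torusPoint {n : ℕ} (Δ : Fan n) (t : Torus n) : Variety Δ :=
  toVariety ⟨⊥, Δ.zero_mem⟩ (torusChart ⊥ t)

/-- The action of the torus on `X(Δ)`. -/
def act {n : ℕ} {Δ : Fan n} (t : Torus n) : Variety Δ → Variety Δ :=
  Quot.map (fun p => ⟨p.1, actChart p.1.1 t p.2⟩) (by
    rintro p q ⟨y, hp, hq⟩
    refine ⟨actChart _ t y, ?_, ?_⟩
    · rw [actChart_chartMap, hp]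
    · rw [actChart_chartMap, hq])

/-- The orbit `O_σ`: the orbit of the distinguished point `P_σ` under the torus. -/
def orbit {n : ℕ} {Δ : Fan n} (σ : Δ.cones) : Set (Variety Δ) :=
  Set.range fun t : Torus n => act t (toVariety σ (distinguishedChart σ.1))

/-- The parametrization `Hom(M(σ), ℂ*) = Spec ℂ[σ^⊥ ∩ M] → X(Δ)` of the orbit `O_σ`, which makes
`O_σ` an algebraic torus with unit `P_σ`. -/
def orbitPoint {n : ℕ} {Δ : Fan n} (σ : Δ.cones) (x : OrbitTorus σ.1) : Variety Δ :=
  toVariety σ (orbitChart σ.1 x)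

/-- The homomorphism `𝕋 → Hom(M(σ), ℂ*)` that restricts characters. -/
def toOrbitTorus {n : ℕ} (σ : Cone n) (t : Torus n) : OrbitTorus σ :=
  (character t).comp (AddMonoidHom.toMultiplicative (perpLattice σ).subtype)

lemma act_orbitPoint {n : ℕ} {Δ : Fan n} (σ : Δ.cones) (t : Torus n) (x : OrbitTorus σ.1) :
    act t (orbitPoint σ x) = orbitPoint σ (toOrbitTorus σ.1 t * x) := by
  change toVariety σ (actChart σ.1 t (orbitChart σ.1 x)) = _
  unfold orbitPoint
  congr 1
  apply chart_ext
  intro m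
  rw [actChart_single, orbitChart_single, orbitChart_single]
  split_ifs with h
  · simp [toOrbitTorus]
  · simp

lemma toOrbitTorus_surjective {n : ℕ} (σ : Cone n) : Function.Surjective (toOrbitTorus σ) := by
  intro x
  have hroot : ∀ {k : ℤ}, k ≠ 0 → Function.Surjective fun a : Additive ℂˣ => k • a := by
    intro k hk a
    obtain ⟨z, hz⟩ := IsAlgClosed.exists_pow_nat_eq ((a.toMul : ℂˣ) : ℂ) (Int.natAbs_pos.2 hk)
    have hz0 : z ≠ 0 := by
      rintro rfl
      rw [zero_pow (Int.natAbs_ne_zero.2 hk)] at hz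
      exact a.toMul.ne_zero hz.symm
    have hu : (Units.mk0 z hz0) ^ k.natAbs = a.toMul := Units.ext (by simpa using hz)
    rcases Int.natAbs_eq k with h | h
    · refine ⟨Additive.ofMul (Units.mk0 z hz0), ?_⟩
      apply Additive.toMul.injective
      change (Units.mk0 z hz0) ^ k = a.toMul
      rw [h, zpow_natCast, hu]
    · refine ⟨Additive.ofMul (Units.mk0 z hz0)⁻¹, ?_⟩
      apply Additive.toMul.injective
      change ((Units.mk0 z hz0)⁻¹) ^ k = a.toMul
      rw [h, inv_zpow', neg_neg, zpow_natCast, hu]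
  let _ : DivisibleBy (Additive ℂˣ) ℤ := divisibleByOfSMulRightSurj _ _ hroot
  obtain ⟨g, hg⟩ := (Module.Baer.of_divisible (Additive ℂˣ)).extension_property_addMonoidHom
    (perpLattice σ).subtype Subtype.val_injective (MonoidHom.toAdditiveRight x)
  refine ⟨fun i => (g (Pi.single i 1)).toMul, ?_⟩
  refine MonoidHom.ext fun m => ?_
  have h1 : (x m) = (g (m.toAdd : Fin n → ℤ)).toMul :=
    congrArg Additive.toMul (DFunLike.congr_fun hg m.toAdd).symm
  rw [h1]
  have h2 : ∀ i, (Pi.single i ((m.toAdd : Fin n → ℤ) i) : Fin n → ℤ) =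
      ((m.toAdd : Fin n → ℤ) i) • Pi.single i 1 := fun i => by
    rw [← Pi.single_smul, smul_eq_mul, mul_one]
  have h3 : g (m.toAdd : Fin n → ℤ) =
      ∑ i, ((m.toAdd : Fin n → ℤ) i) • g (Pi.single i (1 : ℤ)) := by
    conv_lhs => rw [← Finset.univ_sum_single (m.toAdd : Fin n → ℤ), map_sum]
    exact Finset.sum_congr rfl fun i _ => by rw [h2, map_zsmul]
  rw [h3, toMul_sum]
  rfl

/-- The image of the parametrization is the torus orbit. -/
lemma range_orbitPoint {n : ℕ} {Δ : Fan n} (σ : Δ.cones) :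
    Set.range (orbitPoint σ) = orbit σ := by
  have h : ∀ t : Torus n, act t (toVariety σ (distinguishedChart σ.1)) =
      orbitPoint σ (toOrbitTorus σ.1 t) := fun t =>
    (act_orbitPoint σ t 1).trans (congrArg _ (mul_one (M := Multiplicative (perpLattice σ.1) →* ℂˣ) _))
  ext P
  constructor
  · rintro ⟨x, rfl⟩
    obtain ⟨t, rfl⟩ := toOrbitTorus_surjective σ.1 x
    exact ⟨t, h t⟩
  · rintro ⟨t, rfl⟩
    exact ⟨_, (h t).symm⟩

/-! ### Algebraic subgroups of the orbits and divisible hulls -/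

/-- The value of a regular function `f ∈ ℂ[σ^⊥ ∩ M]` at a point of `Hom(M(σ), ℂ*)`. -/
def OrbitTorus.eval {n : ℕ} {σ : Cone n} (x : OrbitTorus σ)
    (f : AddMonoidAlgebra ℂ (perpLattice σ)) : ℂ :=
  AddMonoidAlgebra.lift ℂ ℂ (perpLattice σ) ((Units.coeHom ℂ).comp x) f

/-- An algebraic subgroup is a subgroup that is Zariski closed. -/
def IsAlgebraicSubgroup {n : ℕ} {σ : Cone n} (G : Subgroup (OrbitTorus σ)) : Prop :=
  ∃ I : Set (AddMonoidAlgebra ℂ (perpLattice σ)), ∀ x, x ∈ G ↔ ∀ f ∈ I, OrbitTorus.eval x f = 0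

/-- The divisible hull `G^div = {P | P ^ k ∈ G for some k ≥ 1}`. -/
def divisibleHull {T : Type*} [Group T] (G : Subgroup T) : Set T := {P | ∃ k : ℕ, 1 ≤ k ∧ P ^ k ∈ G}

/-! ### Morphisms, monomial rational maps and their dynamics -/

/-- The points of `U_σ` where `h` does not vanish, as the points of `Spec ℂ[σ^∨ ∩ M]_h`. -/
abbrev BasicOpen {n : ℕ} {σ : Cone n} (h : CoordRing σ) : Type := Localization.Away h →ₐ[ℂ] ℂ

/-- The inclusion of `Spec ℂ[σ^∨ ∩ M]_h` in `U_σ`. -/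
def BasicOpen.toChart {n : ℕ} {σ : Cone n} {h : CoordRing σ} (y : BasicOpen h) : Chart σ :=
  y.comp (IsScalarTower.toAlgHom ℂ (CoordRing σ) (Localization.Away h))

/-- `V` is a Zariski open subset of `X(Δ)` and `f` is a morphism `V → X(Δ)` on it: around every
point of `V` there is a principal open subset of a chart `U_σ` that is contained in `V` and that
`f` maps to a chart `U_σ'` by a homomorphism `F` of the coordinate rings.  (Values of `f` outside
`V` are irrelevant.) -/
def IsMorphismOn {n : ℕ} {Δ : Fan n} (V : Set (Variety Δ)) (f : Variety Δ → Variety Δ) : Prop :=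
  ∀ P ∈ V, ∃ (σ σ' : Δ.cones) (h : CoordRing σ.1) (F : CoordRing σ'.1 →ₐ[ℂ] Localization.Away h),
    (∃ x : BasicOpen h, toVariety σ x.toChart = P) ∧
    ∀ y : BasicOpen h, toVariety σ y.toChart ∈ V ∧
      f (toVariety σ y.toChart) = toVariety σ' (y.comp F)

/-- The rational map `φ_A : X(Δ) ⇢ X(Δ)` is well-defined at `P`, with value `Q`: on some open
neighbourhood of `P` there is a morphism to `X(Δ)` that agrees with `φ_A` on the torus and maps `P`
to `Q`. -/
def MapsTo {n : ℕ} (Δ : Fan n) (A : Matrix (Fin n) (Fin n) ℤ) (P Q : Variety Δ) : Prop :=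
  ∃ (V : Set (Variety Δ)) (f : Variety Δ → Variety Δ), IsMorphismOn V f ∧ P ∈ V ∧ f P = Q ∧
    ∀ t : Torus n, torusPoint Δ t ∈ V → f (torusPoint Δ t) = torusPoint Δ (monomialMap A t)

/-- The sequence `o` is the forward orbit `P, φ_A(P), φ_A²(P), …` (all terms well-defined). -/
def IsForwardOrbit {n : ℕ} (Δ : Fan n) (A : Matrix (Fin n) (Fin n) ℤ) (P : Variety Δ)
    (o : ℕ → Variety Δ) : Prop :=
  o 0 = P ∧ ∀ k, MapsTo Δ A (o k) (o (k + 1))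

/-- The set `X_φ` of the points of `X(Δ)` with a well-defined forward orbit. -/
def wellDefinedLocus {n : ℕ} (Δ : Fan n) (A : Matrix (Fin n) (Fin n) ℤ) : Set (Variety Δ) :=
  {P | ∃ o, IsForwardOrbit Δ A P o}

/-- The set `PrePer(φ)` of preperiodic points: `φ^r(P) = φ^s(P)` for some `r > s ≥ 0`. -/
def prePer {n : ℕ} (Δ : Fan n) (A : Matrix (Fin n) (Fin n) ℤ) : Set (Variety Δ) :=
  {P | ∃ o, IsForwardOrbit Δ A P o ∧ ∃ r s : ℕ, s < r ∧ o r = o s}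

end Toric

end

/-!
The combinatorics behind the theorem is the following.  The rational map `φ_A` is defined at a point
of the orbit `O_σ` if and only if `A` maps `σ` into some cone of the fan; it then maps `O_σ` to the
orbit `O_τ` of the smallest such cone `τ`, by the homomorphism of tori that is dual to
`Aᵀ : M(τ) → M(σ)` (`MapsCone.mapsTo`, `MapsTo.exists_mapsCone`,
`MapsRelint.mapsTo_orbitPoint_iff`).
That the condition on `A` is necessary is seen from limits: a point of `O_σ` is the limit of torus
points along one-parameter subgroups in the relative interior of `σ`, and if a morphism extends
`φ_A` to it, then the characters in `τ^∨` have limits along the images of these curves.  Hence the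
image of `σ` is in the double dual of `τ`, which is `τ` by Farkas' lemma (over `ℚ`, so that integral
forms suffice).

Consequently `X_φ` is the union of the orbits of the cones that remain in cones of the fan under all
iterates of `A` (`survivingFan`, `wellDefinedLocus_eq`).  A face of such a cone has the same
property.

On a surviving orbit `O_σ`, with successive image orbits `O_{σ₀}, O_{σ₁}, …`, the equality
`φ^{s+N}(P) = φ^s(P)` means that `σ_{s+N} = σ_s` and that the characters in the lattice
`D(s, N) = ((Aᵀ)^{s+N} - (Aᵀ)^s) M(σ_s)` are trivial at `P`.  The cones are eventually periodic, and
`D(s + e, K N) ⊆ D(s, N)` (`differenceLattice_le`), so any two of these lattices contain a third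
one.
If `D` is one of minimal rank, every other one contains a multiple of `D`.  The points at which `D`
is trivial form the algebraic subgroup `G_σ`, and a preperiodic point has a power in it.
Conversely, if `P^k ∈ G_σ`, then the points `φ^{s+jN}(P)` all have the same `k`-th power, so two of them agree
(`exists_lt_eqOn_of_pow_eq`, `exists_isAlgebraicSubgroup_prePer`).
-/

noncomputable section

namespace Toric

/-! ### Rational polyhedral cones -/

/-- **Farkas' lemma** over an arbitrary ordered field: a linear form that is nonnegative wherever
the finitely many forms `a i` are is a nonnegative combination of them. -/
theorem exists_nonneg_combination {K W ι : Type*} [Field K] [LinearOrder K] [IsStrictOrderedRing K]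
    [AddCommGroup W] [Module K W] [DecidableEq ι] (s : Finset ι) (a : ι → W →ₗ[K] K) (b : W →ₗ[K] K)
    (h : ∀ x, (∀ i ∈ s, 0 ≤ a i x) → 0 ≤ b x) :
    ∃ y : ι → K, (∀ i, 0 ≤ y i) ∧ b = ∑ i ∈ s, y i • a i := by
  induction s using Finset.induction_on generalizing a b with
  | empty =>
    refine ⟨0, fun _ => le_rfl, LinearMap.ext fun x => le_antisymm ?_ ?_⟩
    · simpa using h (-x) (by simp)
    · simpa using h x (by simp)
  | insert j s hj ih =>
    by_cases h0 : ∀ x, (∀ i ∈ s, 0 ≤ a i x) → 0 ≤ b x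
    · obtain ⟨y, hy, rfl⟩ := ih a b h0
      refine ⟨fun i => if i = j then 0 else y i, fun i => ?_, ?_⟩
      · dsimp only; split_ifs
        exacts [le_rfl, hy i]
      · rw [Finset.sum_insert hj]
        simp only [if_true, zero_smul, zero_add]
        exact Finset.sum_congr rfl fun i hi => by rw [if_neg (ne_of_mem_of_not_mem hi hj)]
    · push Not at h0
      obtain ⟨x₀, hx₀, hb⟩ := h0
      have haj : a j x₀ < 0 := by
        by_contra hc
        push Not at hc
        exact absurd (h x₀ (Finset.forall_mem_insert _ _ _ |>.2 ⟨hc, hx₀⟩)) (not_le.2 hb)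
      -- Project along `x₀` onto the kernel of `a j`, where the remaining forms suffice.
      let p : W →ₗ[K] W := LinearMap.id - ((a j x₀)⁻¹ • a j).smulRight x₀
      have hp : ∀ x, p x = x - ((a j x₀)⁻¹ * a j x) • x₀ := fun x => rfl
      obtain ⟨y, hy, hby⟩ := ih (fun i => (a i).comp p) (b.comp p) (fun x hx =>
        h (p x) (Finset.forall_mem_insert _ _ _ |>.2 ⟨by
          rw [hp, map_sub, map_smul, smul_eq_mul, mul_right_comm, inv_mul_cancel₀ haj.ne, one_mul,
            sub_self], hx⟩))
      -- The coefficient of `a j` is chosen so that the two sides agree at `x₀`.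
      refine ⟨fun i => if i = j then (a j x₀)⁻¹ * (b x₀ - ∑ i ∈ s, y i * a i x₀) else y i,
        fun i => ?_, ?_⟩
      · dsimp only; split_ifs
        · refine mul_nonneg_of_nonpos_of_nonpos (inv_nonpos.2 haj.le) ?_
          have := Finset.sum_nonneg fun i hi => mul_nonneg (hy i) (hx₀ i hi)
          linarith
        · exact hy i
      · rw [Finset.sum_insert hj, Finset.sum_congr rfl fun i hi =>
          show _ = y i • a i by dsimp only; rw [if_neg (ne_of_mem_of_not_mem hi hj)]]
        ext x
        have := LinearMap.congr_fun hby x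
        simp only [LinearMap.comp_apply, hp, map_sub, map_smul, smul_eq_mul, LinearMap.sum_apply,
          LinearMap.smul_apply, mul_sub, Finset.sum_sub_distrib] at this
        simp only [if_true, LinearMap.add_apply, LinearMap.smul_apply, LinearMap.sum_apply,
          smul_eq_mul]
        have h2 : ∑ i ∈ s, y i * ((a j x₀)⁻¹ * a j x * a i x₀) =
            (a j x₀)⁻¹ * a j x * ∑ i ∈ s, y i * a i x₀ := by
          rw [Finset.mul_sum]; exact Finset.sum_congr rfl fun i _ => by ring
        rw [h2] at this
        linear_combination this

/-- The lattice vector `w ∈ N`, as an element of `N_ℝ`. -/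
def latticeVec {n : ℕ} (w : Fin n → ℤ) : Fin n → ℝ := fun i => w i

lemma pairing_eq_dotProduct {n : ℕ} (m : Fin n → ℤ) (v : Fin n → ℝ) :
    pairing m v = latticeVec m ⬝ᵥ v := rfl

lemma pairing_latticeVec {n : ℕ} (m w : Fin n → ℤ) :
    pairing m (latticeVec w) = ((m ⬝ᵥ w : ℤ) : ℝ) := by
  simp [pairing, latticeVec, dotProduct]

lemma latticeVec_add {n : ℕ} (v w : Fin n → ℤ) :
    latticeVec (v + w) = latticeVec v + latticeVec w := by
  ext i; simp [latticeVec]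

lemma pairing_add_right {n : ℕ} (m : Fin n → ℤ) (v w : Fin n → ℝ) :
    pairing m (v + w) = pairing m v + pairing m w := by
  rw [pairing_eq_dotProduct, dotProduct_add]; rfl

lemma pairing_nsmul {n : ℕ} (k : ℕ) (m : Fin n → ℤ) (v : Fin n → ℝ) :
    pairing (k • m) v = k * pairing m v := by
  simp [pairing, Finset.mul_sum, mul_assoc]

/-- The cone generated by a finite set of lattice vectors. -/
def latticeHull {n : ℕ} (S : Finset (Fin n → ℤ)) : Cone n :=
  PointedCone.hull ℝ (latticeVec '' (S : Set (Fin n → ℤ)))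

lemma latticeVec_mem_latticeHull {n : ℕ} {S : Finset (Fin n → ℤ)} {w : Fin n → ℤ} (hw : w ∈ S) :
    latticeVec w ∈ latticeHull S :=
  Submodule.subset_span ⟨w, hw, rfl⟩

lemma dotProduct_nonneg_of_mem_latticeHull {n : ℕ} {S : Finset (Fin n → ℤ)} {u : Fin n → ℝ}
    (h : ∀ w ∈ S, 0 ≤ u ⬝ᵥ latticeVec w) {v : Fin n → ℝ} (hv : v ∈ latticeHull S) :
    0 ≤ u ⬝ᵥ v := by
  induction hv using Submodule.span_induction with
  | mem x hx => obtain ⟨w, hw, rfl⟩ := hx; exact h w hw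
  | zero => simp
  | add x y _ _ hx hy => rw [dotProduct_add]; exact add_nonneg hx hy
  | smul c x _ hx =>
    rw [show c • x = (c : ℝ) • x from rfl, dotProduct_smul]
    exact mul_nonneg c.2 hx

/-- If a form `f` is nonpositive on those generators of a cone on which the nonnegative form `g`
vanishes, then some multiple of `g` dominates `f` on the cone. -/
lemma exists_nat_dotProduct_le {n : ℕ} {S : Finset (Fin n → ℤ)} (f g : Fin n → ℝ)
    (hg : ∀ w ∈ S, 0 ≤ g ⬝ᵥ latticeVec w)
    (hfg : ∀ w ∈ S, g ⬝ᵥ latticeVec w = 0 → f ⬝ᵥ latticeVec w ≤ 0) :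
    ∃ C : ℕ, ∀ v ∈ latticeHull S, f ⬝ᵥ v ≤ C * (g ⬝ᵥ v) := by
  have h1 : ∀ w ∈ S, ∃ C : ℕ, f ⬝ᵥ latticeVec w ≤ C * (g ⬝ᵥ latticeVec w) := by
    intro w hw
    rcases (hg w hw).eq_or_lt with h0 | h0
    · exact ⟨0, by rw [← h0, mul_zero]; exact hfg w hw h0.symm⟩
    · obtain ⟨C, hC⟩ := exists_nat_ge ((f ⬝ᵥ latticeVec w) / (g ⬝ᵥ latticeVec w))
      exact ⟨C, (div_le_iff₀ h0).1 hC⟩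
  choose! C hC using h1
  refine ⟨∑ w ∈ S, C w, fun v hv => ?_⟩
  have := dotProduct_nonneg_of_mem_latticeHull (u := ((∑ w ∈ S, C w : ℕ) : ℝ) • g - f) ?_ hv
  · rw [sub_dotProduct, smul_dotProduct, smul_eq_mul] at this; linarith
  · intro w hw
    rw [sub_dotProduct, smul_dotProduct, smul_eq_mul, sub_nonneg]
    refine (hC w hw).trans (mul_le_mul_of_nonneg_right ?_ (hg w hw))
    exact_mod_cast Finset.single_le_sum (f := C) (fun _ _ => Nat.zero_le _) hw

/-- A lattice vector on which every integral form that is nonnegative on the generators is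
nonnegative lies in the cone. -/
lemma latticeVec_mem_latticeHull_of_dual {n : ℕ} {S : Finset (Fin n → ℤ)} {b : Fin n → ℤ}
    (h : ∀ m : Fin n → ℤ, (∀ w ∈ S, 0 ≤ m ⬝ᵥ w) → 0 ≤ m ⬝ᵥ b) :
    latticeVec b ∈ latticeHull S := by
  classical
  let form : (Fin n → ℤ) → (Fin n → ℚ) →ₗ[ℚ] ℚ := fun w =>
    ∑ i, (w i : ℚ) • LinearMap.proj i
  have hform : ∀ w x, form w x = ∑ i, (w i : ℚ) * x i := fun w x => by
    simp [form, LinearMap.sum_apply]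
  obtain ⟨y, hy, hby⟩ := exists_nonneg_combination S form (form b) (by
    intro x hx
    obtain ⟨N, hN⟩ := IsLocalization.exist_integer_multiples_of_finite (nonZeroDivisors ℤ) x
    have hN0 : ((N : ℤ) : ℚ) ≠ 0 := by exact_mod_cast nonZeroDivisors.coe_ne_zero N
    choose m hm using hN
    -- Multiplying by `N ^ 2` clears the denominators and keeps the signs.
    have hm' : ∀ w, (((N : ℤ) • m) ⬝ᵥ w : ℤ) = ((N : ℤ) : ℚ) ^ 2 * form w x := by
      intro w
      rw [hform, Finset.mul_sum]
      simp only [dotProduct, Int.cast_sum]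
      refine Finset.sum_congr rfl fun i _ => ?_
      have := hm i
      simp only [eq_intCast, zsmul_eq_mul] at this
      simp only [Pi.smul_apply, smul_eq_mul]
      push_cast
      rw [this]; ring
    have key := h ((N : ℤ) • m) (fun w hw => by
      have : (0 : ℚ) ≤ (((N : ℤ) • m) ⬝ᵥ w : ℤ) := by
        rw [hm']; exact mul_nonneg (sq_nonneg _) (hx w hw)
      exact_mod_cast this)
    have : (0 : ℚ) ≤ (((N : ℤ) • m) ⬝ᵥ b : ℤ) := by exact_mod_cast key
    rw [hm'] at this
    exact nonneg_of_mul_nonneg_right this (by positivity))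
  have hb : latticeVec b =
      ∑ w ∈ S, (⟨(y w : ℝ), by exact_mod_cast hy w⟩ : NNReal) • latticeVec w := by
    ext j
    have := LinearMap.congr_fun hby (Pi.single j 1)
    simp only [LinearMap.sum_apply, LinearMap.smul_apply, hform, Pi.single_apply, mul_ite, mul_one,
      mul_zero, Finset.sum_ite_eq', Finset.mem_univ, if_true, smul_eq_mul] at this
    have h2 : ((b j : ℚ) : ℝ) = ((∑ w ∈ S, y w * (w j : ℚ) : ℚ) : ℝ) := by rw [this]
    push_cast at h2
    simpa [latticeVec, NNReal.smul_def] using h2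
  rw [hb]
  exact Submodule.sum_mem _ fun w hw => Submodule.smul_mem _ _ (latticeVec_mem_latticeHull hw)

lemma IsRationalPolyhedral.exists_eq_latticeHull {n : ℕ} {σ : Cone n}
    (hσ : IsRationalPolyhedral σ) : ∃ S, σ = latticeHull S := hσ

/-- The generators of a rational cone suffice to test membership in the dual monoid. -/
lemma mem_dualMonoid_latticeHull {n : ℕ} {S : Finset (Fin n → ℤ)} {m : Fin n → ℤ} :
    m ∈ dualMonoid (latticeHull S) ↔ ∀ w ∈ S, 0 ≤ m ⬝ᵥ w := by
  constructor
  · intro h w hw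
    have := h _ (latticeVec_mem_latticeHull hw)
    rw [pairing_latticeVec] at this
    exact_mod_cast this
  · intro h v hv
    refine dotProduct_nonneg_of_mem_latticeHull (u := latticeVec m) (fun w hw => ?_) hv
    rw [← pairing_eq_dotProduct, pairing_latticeVec]
    exact_mod_cast h w hw

/-- Duality for rational polyhedral cones: `σ ∩ N` is cut out by `σ^∨ ∩ M`. -/
lemma latticeVec_mem_of_dual {n : ℕ} {σ : Cone n} (hσ : IsRationalPolyhedral σ) {b : Fin n → ℤ}
    (h : ∀ m ∈ dualMonoid σ, 0 ≤ m ⬝ᵥ b) : latticeVec b ∈ σ := by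
  obtain ⟨S, rfl⟩ := hσ.exists_eq_latticeHull
  exact latticeVec_mem_latticeHull_of_dual fun m hm => h m (mem_dualMonoid_latticeHull.2 hm)

/-- A cone generated by lattice vectors is contained in another one as soon as its lattice points
are. -/
lemma le_of_latticeVec {n : ℕ} {σ τ : Cone n} (hσ : IsRationalPolyhedral σ)
    (h : ∀ w, latticeVec w ∈ σ → latticeVec w ∈ τ) : σ ≤ τ := by
  obtain ⟨S, rfl⟩ := hσ.exists_eq_latticeHull
  refine Submodule.span_le.2 ?_
  rintro _ ⟨w, hw, rfl⟩
  exact h w (latticeVec_mem_latticeHull hw)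

/-- A lattice point in the relative interior of `σ`: the forms of `σ^∨` that vanish at it vanish
on all of `σ`. -/
lemma exists_relint {n : ℕ} {σ : Cone n} (hσ : IsRationalPolyhedral σ) :
    ∃ v : Fin n → ℤ, latticeVec v ∈ σ ∧ ∀ m ∈ dualMonoid σ, m ⬝ᵥ v = 0 → m ∈ perpLattice σ := by
  obtain ⟨S, rfl⟩ := hσ.exists_eq_latticeHull
  refine ⟨∑ w ∈ S, w, ?_, fun m hm h0 => ?_⟩
  · have : latticeVec (∑ w ∈ S, w) = ∑ w ∈ S, latticeVec w := by
      ext i; simp [latticeVec]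
    rw [this]
    exact Submodule.sum_mem _ fun w hw => latticeVec_mem_latticeHull hw
  · rw [dotProduct_sum, Finset.sum_eq_zero_iff_of_nonneg (mem_dualMonoid_latticeHull.1 hm)] at h0
    have hneg : -m ∈ dualMonoid (latticeHull S) :=
      mem_dualMonoid_latticeHull.2 fun w hw => by rw [neg_dotProduct, h0 w hw, neg_zero]
    intro v hv
    have h1 := hm v hv
    have h2 := hneg v hv
    rw [pairing_neg] at h2
    linarith

/-- If `u ∈ σ^∨`, then a form `m` that is nonnegative on the face `σ ∩ u^⊥` becomes nonnegative on
`σ` after a multiple of `u` is added. -/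
lemma exists_add_nsmul_mem_dualMonoid {n : ℕ} {σ : Cone n} (hσ : IsRationalPolyhedral σ)
    {u m : Fin n → ℤ} (hu : u ∈ dualMonoid σ)
    (h : ∀ v ∈ σ, pairing u v = 0 → 0 ≤ pairing m v) : ∃ k : ℕ, m + k • u ∈ dualMonoid σ := by
  obtain ⟨S, rfl⟩ := hσ.exists_eq_latticeHull
  obtain ⟨C, hC⟩ := exists_nat_dotProduct_le (S := S) (latticeVec (-m)) (latticeVec u)
    (fun w hw => hu _ (latticeVec_mem_latticeHull hw))
    (fun w hw h0 => by
      rw [← pairing_eq_dotProduct, pairing_neg, neg_nonpos]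
      exact h _ (latticeVec_mem_latticeHull hw) h0)
  refine ⟨C, fun v hv => ?_⟩
  have := hC v hv
  rw [← pairing_eq_dotProduct, ← pairing_eq_dotProduct, pairing_neg] at this
  rw [pairing_add, pairing_nsmul]
  linarith

/-- Every face of a rational polyhedral cone is cut out by an integral form. -/
lemma IsFace.exists_integral {n : ℕ} {τ σ : Cone n} (hσ : IsRationalPolyhedral σ)
    (h : IsFace τ σ) : ∃ u ∈ dualMonoid σ, ∀ v, v ∈ τ ↔ v ∈ σ ∧ pairing u v = 0 := by
  classical
  obtain ⟨S, rfl⟩ := hσ.exists_eq_latticeHull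
  obtain ⟨u, hu, hτ⟩ := h
  have hu' : ∀ w ∈ S, 0 ≤ u ⬝ᵥ latticeVec w := fun w hw => hu _ (latticeVec_mem_latticeHull hw)
  let S₀ := S.filter fun w => u ⬝ᵥ latticeVec w = 0
  -- Separate `-w` from the cone generated by `σ` and `-τ`, for each generator `w` outside `τ`.
  have h1 : ∀ w ∈ S, u ⬝ᵥ latticeVec w ≠ 0 →
      ∃ m : Fin n → ℤ, (∀ w ∈ S, 0 ≤ m ⬝ᵥ w) ∧ (∀ w ∈ S₀, m ⬝ᵥ w = 0) ∧ 0 < m ⬝ᵥ w := by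
    intro w hw hw0
    by_contra hc
    push Not at hc
    have hmem : latticeVec (-w) ∈ latticeHull (S ∪ S₀.image fun w => -w) := by
      refine latticeVec_mem_latticeHull_of_dual fun m hm => ?_
      have hmS : ∀ w ∈ S, 0 ≤ m ⬝ᵥ w := fun w hw => hm w (Finset.mem_union_left _ hw)
      rw [dotProduct_neg, neg_nonneg]
      refine hc m hmS fun w hw => le_antisymm ?_ (hmS w (Finset.mem_filter.1 hw).1)
      have := hm (-w) (Finset.mem_union_right _ (Finset.mem_image_of_mem _ hw))
      rwa [dotProduct_neg, neg_nonneg] at this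
    have hneg : ∀ w : Fin n → ℤ, latticeVec (-w) = -latticeVec w := fun w => by
      ext i; simp [latticeVec]
    have h2 := dotProduct_nonneg_of_mem_latticeHull (u := u) (fun w hw => by
      rcases Finset.mem_union.1 hw with hw | hw
      · exact hu' w hw
      · obtain ⟨w', hw', rfl⟩ := Finset.mem_image.1 hw
        rw [hneg, dotProduct_neg, (Finset.mem_filter.1 hw').2, neg_zero]) hmem
    rw [hneg, dotProduct_neg, neg_nonneg] at h2
    exact hw0 (le_antisymm h2 (hu' w hw))
  choose! m hm hm0 hmpos using h1
  let S₁ := S.filter fun w => u ⬝ᵥ latticeVec w ≠ 0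
  have hS₁ : ∀ w ∈ S₁, w ∈ S ∧ u ⬝ᵥ latticeVec w ≠ 0 := fun w hw => Finset.mem_filter.1 hw
  have hsum : ∀ w, (∑ w' ∈ S₁, m w') ⬝ᵥ w = ∑ w' ∈ S₁, m w' ⬝ᵥ w := fun w => sum_dotProduct _ _ _
  have hpair : ∀ w, latticeVec (∑ w' ∈ S₁, m w') ⬝ᵥ latticeVec w =
      ((∑ w' ∈ S₁, m w' ⬝ᵥ w : ℤ) : ℝ) := fun w => by
    rw [← pairing_eq_dotProduct, pairing_latticeVec, hsum]
  have hnn : ∀ w ∈ S, 0 ≤ ∑ w' ∈ S₁, m w' ⬝ᵥ w := fun w hw =>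
    Finset.sum_nonneg fun w' hw' => hm w' (hS₁ w' hw').1 (hS₁ w' hw').2 w hw
  have hdual : (∑ w ∈ S₁, m w) ∈ dualMonoid (latticeHull S) :=
    mem_dualMonoid_latticeHull.2 fun w hw => by rw [hsum]; exact hnn w hw
  refine ⟨∑ w ∈ S₁, m w, hdual, fun v => (hτ v).trans (and_congr_right fun hv => ?_)⟩
  rw [pairing_eq_dotProduct]
  constructor
  · intro h0
    obtain ⟨C, hC⟩ := exists_nat_dotProduct_le (S := S) (latticeVec (∑ w ∈ S₁, m w)) u hu'
      (fun w hw h0 => by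
        rw [hpair, Finset.sum_eq_zero fun w' hw' => hm0 w' (hS₁ w' hw').1 (hS₁ w' hw').2 w
          (Finset.mem_filter.2 ⟨hw, h0⟩)]
        simp)
    have := hC v hv
    rw [h0, mul_zero] at this
    exact le_antisymm this (hdual v hv)
  · intro h0
    obtain ⟨C, hC⟩ := exists_nat_dotProduct_le (S := S) u (latticeVec (∑ w ∈ S₁, m w))
      (fun w hw => by rw [hpair]; exact_mod_cast hnn w hw)
      (fun w hw h0 => by
        by_contra hc
        have hw1 : w ∈ S₁ := Finset.mem_filter.2 ⟨hw, fun h => hc h.le⟩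
        rw [hpair] at h0
        have h0' : ∑ w' ∈ S₁, m w' ⬝ᵥ w = 0 := by exact_mod_cast h0
        rw [Finset.sum_eq_zero_iff_of_nonneg fun w' hw' =>
          hm w' (hS₁ w' hw').1 (hS₁ w' hw').2 w hw] at h0'
        exact (hmpos w hw (hS₁ w hw1).2).ne' (h0' w hw1))
    have := hC v hv
    rw [h0, mul_zero] at this
    exact le_antisymm this (hu v hv)

/-! ### Orbit decomposition of the charts -/

@[simp] lemma chartMap_single {n : ℕ} {τ σ : Cone n} (h : τ ≤ σ) (x : Chart τ) (m : dualMonoid σ) :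
    chartMap h x (AddMonoidAlgebra.single m 1) =
      x (AddMonoidAlgebra.single ⟨m, dualMonoid_anti h m.2⟩ 1) := by
  simp [chartMap]
  rfl

lemma chartMap_chartMap {n : ℕ} {ρ τ σ : Cone n} (h : ρ ≤ τ) (h' : τ ≤ σ) (x : Chart ρ) :
    chartMap h' (chartMap h x) = chartMap (h.trans h') x :=
  chart_ext fun m => by simp

lemma chartMap_refl {n : ℕ} {σ : Cone n} (x : Chart σ) : chartMap le_rfl x = x :=
  chart_ext fun m => by simp

lemma chart_add {n : ℕ} {σ : Cone n} (x : Chart σ) (a b : dualMonoid σ) :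
    x (AddMonoidAlgebra.single (a + b) 1) =
      x (AddMonoidAlgebra.single a 1) * x (AddMonoidAlgebra.single b 1) := by
  rw [← map_mul, AddMonoidAlgebra.single_mul_single, one_mul]

lemma chart_nsmul {n : ℕ} {σ : Cone n} (x : Chart σ) (k : ℕ) (a : dualMonoid σ) :
    x (AddMonoidAlgebra.single (k • a) 1) = x (AddMonoidAlgebra.single a 1) ^ k := by
  rw [← map_pow, AddMonoidAlgebra.single_pow, one_pow]

lemma chart_zero {n : ℕ} {σ : Cone n} (x : Chart σ) :
    x (AddMonoidAlgebra.single 0 1) = 1 :=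
  map_one x

/-- The face `σ ∩ u^⊥` cut out by an integral form. -/
def cutFace {n : ℕ} (σ : Cone n) (u : Fin n → ℤ) : Cone n where
  carrier := {v | v ∈ σ ∧ pairing u v = 0}
  zero_mem' := ⟨σ.zero_mem, by simp [pairing]⟩
  add_mem' ha hb := ⟨add_mem ha.1 hb.1, by rw [pairing_add_right, ha.2, hb.2, add_zero]⟩
  smul_mem' c v hv := ⟨Submodule.smul_mem σ c hv.1, by
    rw [show c • v = (c : ℝ) • v from rfl, pairing_eq_dotProduct, dotProduct_smul,
      ← pairing_eq_dotProduct, hv.2, smul_zero]⟩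

lemma cutFace_le {n : ℕ} (σ : Cone n) (u : Fin n → ℤ) : cutFace σ u ≤ σ := fun _ h => h.1

lemma isFace_cutFace {n : ℕ} {σ : Cone n} {u : Fin n → ℤ} (hu : u ∈ dualMonoid σ) :
    IsFace (cutFace σ u) σ :=
  ⟨latticeVec u, hu, fun _ => Iff.rfl⟩

/-- The characters that do not vanish at a point `x` of `U_σ` are those orthogonal to some
face of `σ`. -/
lemma exists_face_ne_zero_iff {n : ℕ} {σ : Cone n} (hσ : IsRationalPolyhedral σ) (x : Chart σ) :
    ∃ u : dualMonoid σ, ∀ m : dualMonoid σ,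
      x (AddMonoidAlgebra.single m 1) ≠ 0 ↔ (m : Fin n → ℤ) ∈ perpLattice (cutFace σ u) := by
  classical
  obtain ⟨S, rfl⟩ := hσ.exists_eq_latticeHull
  let Z : AddSubmonoid (dualMonoid (latticeHull S)) :=
    { carrier := {m | x (AddMonoidAlgebra.single m 1) ≠ 0}
      zero_mem' := by
        change x (AddMonoidAlgebra.single 0 1) ≠ 0
        rw [chart_zero]; exact one_ne_zero
      add_mem' := fun {a b} ha hb => by
        change x (AddMonoidAlgebra.single (a + b) 1) ≠ 0
        rw [chart_add]; exact mul_ne_zero ha hb }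
  have hZ : ∀ m, m ∈ Z ↔ x (AddMonoidAlgebra.single m 1) ≠ 0 := fun m => Iff.rfl
  -- The sum of sufficiently many elements of `Z` is positive on every generator on which some
  -- element of `Z` is.
  let S₁ := S.filter fun w => ∃ m ∈ Z, 0 < (m : Fin n → ℤ) ⬝ᵥ w
  have hS₁ : ∀ w ∈ S₁, ∃ m ∈ Z, 0 < (m : Fin n → ℤ) ⬝ᵥ w := fun w hw => (Finset.mem_filter.1 hw).2
  choose! m hmZ hmpos using hS₁
  have huZ : ∑ w ∈ S₁, m w ∈ Z := sum_mem hmZ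
  set u := ∑ w ∈ S₁, m w with hu
  have hgen : ∀ m' ∈ Z, ∀ w ∈ S, (u : Fin n → ℤ) ⬝ᵥ w = 0 → (m' : Fin n → ℤ) ⬝ᵥ w ≤ 0 := by
    intro m' hm' w hw h0
    by_contra hc
    push Not at hc
    have hw1 : w ∈ S₁ := Finset.mem_filter.2 ⟨hw, m', hm', hc⟩
    rw [hu, AddSubmonoid.coe_finsetSum, sum_dotProduct, Finset.sum_eq_zero_iff_of_nonneg
      fun w' _ => mem_dualMonoid_latticeHull.1 (m w').2 w hw] at h0
    exact (hmpos w hw1).ne' (h0 w hw1)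
  refine ⟨u, fun m' => ⟨fun hm' => ?_, fun hm' => ?_⟩⟩
  · obtain ⟨C, hC⟩ := exists_nat_dotProduct_le (S := S) (latticeVec m') (latticeVec u)
      (fun w hw => u.2 _ (latticeVec_mem_latticeHull hw))
      (fun w hw h0 => by
        rw [← pairing_eq_dotProduct, pairing_latticeVec] at h0 ⊢
        exact_mod_cast hgen m' hm' w hw (by exact_mod_cast h0))
    intro v hv
    have := hC v hv.1
    rw [← pairing_eq_dotProduct, ← pairing_eq_dotProduct, hv.2, mul_zero] at this
    exact le_antisymm this (m'.2 v hv.1)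
  · obtain ⟨k, hk⟩ := exists_add_nsmul_mem_dualMonoid hσ (m := -m') u.2 (fun v hv h0 => by
      rw [pairing_neg, hm' v ⟨hv, h0⟩, neg_zero])
    have h1 : m' + ⟨_, hk⟩ = k • u := Subtype.ext (by simp)
    have h2 := (hZ _).1 (nsmul_mem huZ k)
    rw [← h1, chart_add] at h2
    exact left_ne_zero_of_mul h2

/-- Every point of `U_σ` lies in the orbit `O_τ` of a face `τ` of `σ`. -/
lemma exists_chartMap_orbitChart {n : ℕ} {σ : Cone n} (hσ : IsRationalPolyhedral σ)
    (x : Chart σ) : ∃ (τ : Cone n) (_ : IsFace τ σ) (h : τ ≤ σ) (z : OrbitTorus τ),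
      x = chartMap h (orbitChart τ z) := by
  obtain ⟨u, hu⟩ := exists_face_ne_zero_iff hσ x
  have hu0 : x (AddMonoidAlgebra.single u 1) ≠ 0 := (hu u).2 fun v hv => hv.2
  have hk : ∀ m : perpLattice (cutFace σ u), ∃ k : ℕ, (m + k • u : Fin n → ℤ) ∈ dualMonoid σ :=
    fun m => exists_add_nsmul_mem_dualMonoid hσ u.2 fun v hv h0 => (m.2 v ⟨hv, h0⟩).ge
  choose k hk using hk
  let a : perpLattice (cutFace σ u) → dualMonoid σ := fun m => ⟨_, hk m⟩
  have ha : ∀ m, x (AddMonoidAlgebra.single (a m) 1) ≠ 0 := fun m => by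
    rw [hu]
    exact add_mem m.2 (nsmul_mem (fun v hv => hv.2) _)
  -- A character `m` of the face is the difference of `m + k u` and `k u`, both of which are in
  -- `σ^∨` and do not vanish at `x`.
  let z : OrbitTorus (cutFace σ u) := MonoidHom.mk' (fun m =>
    Units.mk0 _ (ha m.toAdd) / Units.mk0 _ hu0 ^ k m.toAdd) (by
      intro m m'
      rw [div_mul_div_comm, ← pow_add, div_eq_div_iff_mul_eq_mul]
      ext
      push_cast
      simp only [Units.val_mk0]
      rw [← chart_nsmul, ← chart_nsmul, ← chart_add, ← chart_add, ← chart_add]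
      congr 2
      apply Subtype.ext
      simp only [a, toAdd_mul, AddSubmonoid.coe_add, AddSubgroup.coe_add,
        AddSubmonoidClass.coe_nsmul, add_smul]
      abel)
  refine ⟨cutFace σ u, isFace_cutFace u.2, cutFace_le σ u, z, chart_ext fun m => ?_⟩
  rw [chartMap_single, orbitChart_single]
  split_ifs with h
  · change _ = ((Units.mk0 _ (ha ⟨m, h⟩) / Units.mk0 _ hu0 ^ k ⟨m, h⟩ : ℂˣ) : ℂ)
    push_cast
    simp only [Units.val_mk0]
    rw [eq_div_iff (pow_ne_zero _ hu0), ← chart_nsmul, ← chart_add]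
    rfl
  · by_contra hc
    exact h ((hu m).1 hc)

/-- The face and the point of its torus that represent a point of `U_σ` are unique. -/
lemma chartMap_orbitChart_unique {n : ℕ} {σ : Cone n} (hσ : IsRationalPolyhedral σ)
    {τ τ' : Cone n} (hτ : IsFace τ σ) (hτ' : IsFace τ' σ) (h : τ ≤ σ) (h' : τ' ≤ σ)
    {z : OrbitTorus τ} {z' : OrbitTorus τ'}
    (heq : chartMap h (orbitChart τ z) = chartMap h' (orbitChart τ' z')) :
    (⟨τ, z⟩ : Σ τ : Cone n, OrbitTorus τ) = ⟨τ', z'⟩ := by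
  have key : ∀ {τ τ' : Cone n} (_ : IsFace τ' σ) (h : τ ≤ σ) (h' : τ' ≤ σ)
      {z : OrbitTorus τ} {z' : OrbitTorus τ'}
      (_ : chartMap h (orbitChart τ z) = chartMap h' (orbitChart τ' z')), τ ≤ τ' := by
    intro τ τ' hτ' h h' z z' heq v hv
    obtain ⟨u, hu, hu'⟩ := hτ'.exists_integral hσ
    have h1 := congrArg (fun x : Chart σ => x (AddMonoidAlgebra.single ⟨u, hu⟩ 1)) heq
    have hu2 : u ∈ perpLattice τ' := fun v hv => ((hu' v).1 hv).2
    simp only [chartMap_single, orbitChart_single] at h1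
    rw [dif_pos hu2] at h1
    split_ifs at h1 with hu3
    · exact (hu' v).2 ⟨h hv, hu3 v hv⟩
    · exact absurd h1.symm (Units.ne_zero _)
  obtain rfl : τ = τ' := le_antisymm (key hτ' h h' heq) (key hτ h' h heq.symm)
  congr 1
  obtain ⟨u, hu, hu'⟩ := hτ.exists_integral hσ
  have hval : ∀ m (_ : m ∈ dualMonoid σ) (hm' : m ∈ perpLattice τ),
      z (Multiplicative.ofAdd ⟨m, hm'⟩) = z' (Multiplicative.ofAdd ⟨m, hm'⟩) := by
    intro m hm hm'
    have h1 := congrArg (fun x : Chart σ => x (AddMonoidAlgebra.single ⟨m, hm⟩ 1)) heq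
    simp only [chartMap_single, orbitChart_single] at h1
    rw [dif_pos hm', dif_pos hm'] at h1
    exact Units.ext h1
  have huτ : u ∈ perpLattice τ := fun v hv => ((hu' v).1 hv).2
  refine MonoidHom.ext fun m => ?_
  obtain ⟨k, hk⟩ := exists_add_nsmul_mem_dualMonoid hσ (m := (m.toAdd : Fin n → ℤ)) hu
    fun v hv h0 => (m.toAdd.2 v ((hu' v).2 ⟨hv, h0⟩)).ge
  have hm : m = Multiplicative.ofAdd ⟨_, add_mem m.toAdd.2 (nsmul_mem huτ k)⟩ /
      (Multiplicative.ofAdd ⟨u, huτ⟩) ^ k := by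
    apply Multiplicative.toAdd.injective
    apply Subtype.ext
    simp
  rw [hm, map_div, map_div, map_pow, map_pow, hval _ hk, hval _ hu]

/-! ### Orbit decomposition of the toric variety -/

lemma Fan.isFace_of_le {n : ℕ} {Δ : Fan n} {τ σ : Cone n} (hτ : τ ∈ Δ.cones) (hσ : σ ∈ Δ.cones)
    (h : τ ≤ σ) : IsFace τ σ := by
  have := (Δ.inter_face τ hτ σ hσ).2
  rwa [inf_eq_left.2 h] at this

lemma toVariety_chartMap {n : ℕ} {Δ : Fan n} (τ σ : Δ.cones) (h : τ.1 ≤ σ.1) (y : Chart τ.1) :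
    toVariety σ (chartMap h y) = toVariety τ y :=
  Quot.sound ⟨chartMap (le_inf h le_rfl) y, chartMap_chartMap _ _ _,
    (chartMap_chartMap _ _ _).trans (chartMap_refl y)⟩

/-- The cone `τ` and the point of the torus `O_τ` that represent a point of a chart. -/
def chartNormalForm {n : ℕ} {Δ : Fan n} (p : Σ σ : Δ.cones, Chart σ.1) :
    Σ τ : Cone n, OrbitTorus τ :=
  have h := exists_chartMap_orbitChart (Δ.rational p.1.1 p.1.2) p.2
  ⟨h.choose, h.choose_spec.choose_spec.choose_spec.choose⟩

lemma chartNormalForm_eq {n : ℕ} {Δ : Fan n} {σ : Δ.cones} {x : Chart σ.1} {τ : Cone n}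
    (hτ : τ ∈ Δ.cones) {z : OrbitTorus τ} (h : τ ≤ σ.1) (hx : x = chartMap h (orbitChart τ z)) :
    chartNormalForm ⟨σ, x⟩ = ⟨τ, z⟩ := by
  have h1 := exists_chartMap_orbitChart (Δ.rational σ.1 σ.2) x
  exact chartMap_orbitChart_unique (Δ.rational σ.1 σ.2) h1.choose_spec.choose
    (Δ.isFace_of_le hτ σ.2 h) h1.choose_spec.choose_spec.choose h
    (h1.choose_spec.choose_spec.choose_spec.choose_spec.symm.trans hx)

lemma exists_eq_chartMap {n : ℕ} {Δ : Fan n} (σ : Δ.cones) (x : Chart σ.1) :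
    ∃ (τ : Δ.cones) (h : τ.1 ≤ σ.1) (z : OrbitTorus τ.1), x = chartMap h (orbitChart τ.1 z) := by
  obtain ⟨τ, hτ, h, z, hx⟩ := exists_chartMap_orbitChart (Δ.rational σ.1 σ.2) x
  exact ⟨⟨τ, Δ.face_mem _ σ.2 _ hτ⟩, h, z, hx⟩

/-- The cone `τ` and the point of the torus `O_τ` that represent a point of `X(Δ)`. -/
def normalForm {n : ℕ} {Δ : Fan n} : Variety Δ → Σ τ : Cone n, OrbitTorus τ :=
  Quot.lift chartNormalForm (by
    rintro ⟨σ, x⟩ ⟨σ', x'⟩ ⟨y, hx, hx'⟩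
    have hmem : σ.1 ⊓ σ'.1 ∈ Δ.cones :=
      Δ.face_mem _ σ.2 _ (Δ.inter_face _ σ.2 _ σ'.2).1
    obtain ⟨τ, h, z, rfl⟩ := exists_eq_chartMap (⟨_, hmem⟩ : Δ.cones) y
    rw [chartNormalForm_eq τ.2 (z := z) (h.trans inf_le_left)
        (hx.symm.trans (chartMap_chartMap _ _ _)),
      chartNormalForm_eq τ.2 (z := z) (h.trans inf_le_right)
        (hx'.symm.trans (chartMap_chartMap _ _ _))])

lemma normalForm_orbitPoint {n : ℕ} {Δ : Fan n} (σ : Δ.cones) (z : OrbitTorus σ.1) :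
    normalForm (orbitPoint σ z) = ⟨σ.1, z⟩ :=
  chartNormalForm_eq σ.2 le_rfl (chartMap_refl _).symm

lemma toVariety_orbitChart {n : ℕ} {Δ : Fan n} {τ σ : Δ.cones} (h : τ.1 ≤ σ.1)
    (z : OrbitTorus τ.1) : toVariety σ (chartMap h (orbitChart τ.1 z)) = orbitPoint τ z :=
  toVariety_chartMap τ σ h _

lemma exists_eq_orbitPoint {n : ℕ} {Δ : Fan n} (P : Variety Δ) :
    ∃ (σ : Δ.cones) (z : OrbitTorus σ.1), P = orbitPoint σ z := by
  obtain ⟨⟨σ, x⟩, rfl⟩ := Quot.exists_rep P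
  obtain ⟨τ, h, z, rfl⟩ := exists_eq_chartMap σ x
  exact ⟨τ, z, toVariety_orbitChart h z⟩

lemma orbitPoint_eq_iff {n : ℕ} {Δ : Fan n} {σ σ' : Δ.cones} {z : OrbitTorus σ.1}
    {z' : OrbitTorus σ'.1} : orbitPoint σ z = orbitPoint σ' z' ↔
      (⟨σ, z⟩ : Σ σ : Δ.cones, OrbitTorus σ.1) = ⟨σ', z'⟩ := by
  constructor
  · intro h
    have h1 := congrArg normalForm h
    rw [normalForm_orbitPoint, normalForm_orbitPoint] at h1
    obtain ⟨σ, hσ⟩ := σ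
    obtain ⟨σ', hσ'⟩ := σ'
    obtain rfl : σ = σ' := congrArg Sigma.fst h1
    obtain rfl : z = z' := eq_of_heq (Sigma.mk.inj h1).2
    rfl
  · intro h
    cases h
    rfl

lemma orbitPoint_injective {n : ℕ} {Δ : Fan n} (σ : Δ.cones) :
    Function.Injective (orbitPoint σ) := fun _ _ h =>
  eq_of_heq (Sigma.mk.inj (orbitPoint_eq_iff.1 h)).2

lemma eq_of_orbitPoint_eq {n : ℕ} {Δ : Fan n} {σ σ' : Δ.cones} {z : OrbitTorus σ.1}
    {z' : OrbitTorus σ'.1} (h : orbitPoint σ z = orbitPoint σ' z') : σ = σ' :=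
  congrArg Sigma.fst (orbitPoint_eq_iff.1 h)

/-- Distinct cones have disjoint orbits. -/
lemma disjoint_orbit {n : ℕ} {Δ : Fan n} {σ σ' : Δ.cones} (h : σ ≠ σ') :
    Disjoint (orbit σ) (orbit σ') := by
  rw [← range_orbitPoint, ← range_orbitPoint, Set.disjoint_left]
  rintro _ ⟨z, rfl⟩ ⟨z', h'⟩
  exact h (eq_of_orbitPoint_eq h'.symm)

/-- A point of the orbit `O_τ` lies in the chart `U_σ` only if `τ` is a face of `σ`. -/
lemma eq_chartMap_of_toVariety_eq {n : ℕ} {Δ : Fan n} {σ τ : Δ.cones} {x : Chart σ.1}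
    {z : OrbitTorus τ.1} (h : toVariety σ x = orbitPoint τ z) :
    ∃ hle : τ.1 ≤ σ.1, x = chartMap hle (orbitChart τ.1 z) := by
  obtain ⟨τ', hle, z', rfl⟩ := exists_eq_chartMap σ x
  rw [toVariety_orbitChart, orbitPoint_eq_iff] at h
  cases h
  exact ⟨hle, rfl⟩

/-- The charts of `X(Δ)` are injective. -/
lemma toVariety_injective {n : ℕ} {Δ : Fan n} (σ : Δ.cones) :
    Function.Injective (toVariety (Δ := Δ) σ) := by
  intro x y h
  obtain ⟨τ, hle, z, rfl⟩ := exists_eq_chartMap σ y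
  rw [toVariety_orbitChart] at h
  exact (eq_chartMap_of_toVariety_eq h).2

open Filter Topology Matrix

/-! ### Toric morphisms between charts -/

/-- The linear map of `N_ℝ` given by `A` maps the cone `σ` into the cone `τ`. -/
def MapsCone {n : ℕ} (A : Matrix (Fin n) (Fin n) ℤ) (σ τ : Cone n) : Prop :=
  ∀ v ∈ σ, A.map (Int.cast : ℤ → ℝ) *ᵥ v ∈ τ

lemma pairing_vecMul {n : ℕ} (A : Matrix (Fin n) (Fin n) ℤ) (m : Fin n → ℤ) (v : Fin n → ℝ) :
    pairing (m ᵥ* A) v = pairing m (A.map (Int.cast : ℤ → ℝ) *ᵥ v) := by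
  rw [pairing_eq_dotProduct, pairing_eq_dotProduct, dotProduct_mulVec]
  congr 1
  ext i
  simp [latticeVec, vecMul, dotProduct]

lemma MapsCone.vecMul_mem_dualMonoid {n : ℕ} {A : Matrix (Fin n) (Fin n) ℤ} {σ τ : Cone n}
    (h : MapsCone A σ τ) {m : Fin n → ℤ} (hm : m ∈ dualMonoid τ) : m ᵥ* A ∈ dualMonoid σ :=
  fun v hv => by rw [pairing_vecMul]; exact hm _ (h v hv)

lemma MapsCone.vecMul_mem_perpLattice {n : ℕ} {A : Matrix (Fin n) (Fin n) ℤ} {σ τ : Cone n}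
    (h : MapsCone A σ τ) {m : Fin n → ℤ} (hm : m ∈ perpLattice τ) : m ᵥ* A ∈ perpLattice σ :=
  fun v hv => by rw [pairing_vecMul]; exact hm _ (h v hv)

/-- The homomorphism `χᵐ ↦ χ^{Aᵀm}` of coordinate rings, if `A` maps `σ` into `τ`. -/
def MapsCone.coordMap {n : ℕ} {A : Matrix (Fin n) (Fin n) ℤ} {σ τ : Cone n}
    (h : MapsCone A σ τ) : CoordRing τ →ₐ[ℂ] CoordRing σ :=
  AddMonoidAlgebra.mapDomainAlgHom ℂ ℂ
    { toFun := fun m : dualMonoid τ =>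
        (⟨(m : Fin n → ℤ) ᵥ* A, h.vecMul_mem_dualMonoid m.2⟩ : dualMonoid σ)
      map_zero' := Subtype.ext (zero_vecMul A)
      map_add' := fun a b => Subtype.ext (add_vecMul A a.1 b.1) }

/-- The toric morphism `U_σ → U_τ` given by `A`, if `A` maps `σ` into `τ`. -/
def MapsCone.toricMap {n : ℕ} {A : Matrix (Fin n) (Fin n) ℤ} {σ τ : Cone n}
    (h : MapsCone A σ τ) (x : Chart σ) : Chart τ :=
  x.comp h.coordMap

lemma MapsCone.toricMap_single {n : ℕ} {A : Matrix (Fin n) (Fin n) ℤ} {σ τ : Cone n}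
    (h : MapsCone A σ τ) (x : Chart σ) (m : dualMonoid τ) :
    h.toricMap x (AddMonoidAlgebra.single m 1) =
      x (AddMonoidAlgebra.single ⟨(m : Fin n → ℤ) ᵥ* A, h.vecMul_mem_dualMonoid m.2⟩ 1) := by
  simp [toricMap, coordMap]

lemma torusChart_single {n : ℕ} (σ : Cone n) (t : Torus n) (m : dualMonoid σ) :
    torusChart σ t (AddMonoidAlgebra.single m 1) =
      (character t (Multiplicative.ofAdd (m : Fin n → ℤ)) : ℂ) := by
  simp [torusChart]

lemma character_monomialMap {n : ℕ} (A : Matrix (Fin n) (Fin n) ℤ) (t : Torus n)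
    (m : Fin n → ℤ) : character (monomialMap A t) (Multiplicative.ofAdd m) =
      character t (Multiplicative.ofAdd (m ᵥ* A)) := by
  change ∏ i, (∏ j, t j ^ A i j) ^ m i = ∏ j, t j ^ (∑ i, m i * A i j)
  simp_rw [← Finset.prod_zpow]
  rw [Finset.prod_comm]
  refine Finset.prod_congr rfl fun j _ => ?_
  have h : ∀ (s : Finset (Fin n)) (f : Fin n → ℤ), t j ^ (∑ i ∈ s, f i) = ∏ i ∈ s, t j ^ f i :=
    fun s f => map_sum (zpowersHom ℂˣ (t j)).toAdditiveRight f s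
  rw [h]
  exact Finset.prod_congr rfl fun i _ => by rw [← _root_.zpow_mul, mul_comm]

lemma MapsCone.toricMap_torusChart {n : ℕ} {A : Matrix (Fin n) (Fin n) ℤ} {σ τ : Cone n}
    (h : MapsCone A σ τ) (t : Torus n) :
    h.toricMap (torusChart σ t) = torusChart τ (monomialMap A t) :=
  chart_ext fun m => by
    rw [h.toricMap_single, torusChart_single, torusChart_single, character_monomialMap]

lemma torusPoint_eq {n : ℕ} {Δ : Fan n} (σ : Δ.cones) (t : Torus n) :
    torusPoint Δ t = toVariety σ (torusChart σ.1 t) := by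
  rw [torusPoint, ← toVariety_chartMap ⟨⊥, Δ.zero_mem⟩ σ bot_le]
  congr 1
  exact chart_ext fun m => by rw [chartMap_single, torusChart_single, torusChart_single]

lemma exists_toChart_eq {n : ℕ} {σ : Cone n} {h : CoordRing σ} {x : Chart σ} (hx : x h ≠ 0) :
    ∃ y : BasicOpen h, y.toChart = x := by
  refine ⟨IsLocalization.liftAlgHom (M := Submonoid.powers h) (f := x) ?_, ?_⟩
  · rintro ⟨_, k, rfl⟩
    rw [map_pow]
    exact (IsUnit.mk0 _ hx).pow k
  · refine AlgHom.ext fun a => ?_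
    simp [BasicOpen.toChart]

/-- Where `A` maps the cone of a chart into a cone of the fan, the rational map is defined and is
given by the toric morphism. -/
lemma MapsCone.mapsTo {n : ℕ} {Δ : Fan n} {A : Matrix (Fin n) (Fin n) ℤ} {σ τ : Δ.cones}
    (h : MapsCone A σ.1 τ.1) (x : Chart σ.1) :
    MapsTo Δ A (toVariety σ x) (toVariety τ (h.toricMap x)) := by
  have hf : ∀ x, Function.extend (toVariety (Δ := Δ) σ) (fun x => toVariety τ (h.toricMap x)) id
      (toVariety σ x) = toVariety τ (h.toricMap x) :=
    (toVariety_injective σ).extend_apply _ _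
  refine ⟨Set.range (toVariety σ), _, ?_, ⟨x, rfl⟩, hf x, fun t _ => ?_⟩
  · rintro _ ⟨x, rfl⟩
    refine ⟨σ, τ, 1, (IsScalarTower.toAlgHom ℂ (CoordRing σ.1) (Localization.Away 1)).comp
      h.coordMap, ?_, fun y => ⟨⟨_, rfl⟩, hf _⟩⟩
    obtain ⟨y, hy⟩ := exists_toChart_eq (h := 1) (x := x) (by rw [map_one]; exact one_ne_zero)
    exact ⟨y, by rw [hy]⟩
  · rw [torusPoint_eq σ, hf, h.toricMap_torusChart, torusPoint_eq τ]

/-! ### One-parameter subgroups and limits -/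

/-- The points `λ_v(2⁻ʲ) t`, `j = 0, 1, …`, on the translate by `t` of the one-parameter subgroup
`λ_v`. -/
def oneParam {n : ℕ} (t : Torus n) (v : Fin n → ℤ) (j : ℕ) : Torus n :=
  fun i => t i * ((Units.mk0 (2⁻¹ : ℂ) (by norm_num)) ^ j) ^ v i

lemma character_oneParam {n : ℕ} (t : Torus n) (v : Fin n → ℤ) (j : ℕ) (m : Fin n → ℤ) :
    (character (oneParam t v j) (Multiplicative.ofAdd m) : ℂ) =
      character t (Multiplicative.ofAdd m) * (2⁻¹ ^ (m ⬝ᵥ v)) ^ j := by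
  have h : character (oneParam t v j) (Multiplicative.ofAdd m) =
      character t (Multiplicative.ofAdd m) *
        ((Units.mk0 (2⁻¹ : ℂ) (by norm_num)) ^ (m ⬝ᵥ v)) ^ j := by
    change ∏ i, (t i * ((Units.mk0 (2⁻¹ : ℂ) (by norm_num)) ^ j) ^ v i) ^ m i =
      (∏ i, t i ^ m i) * _
    simp_rw [mul_zpow, Finset.prod_mul_distrib]
    congr 1
    have h : ∀ (a : ℂˣ) (s : Finset (Fin n)) (f : Fin n → ℤ),
        a ^ (∑ i ∈ s, f i) = ∏ i ∈ s, a ^ f i :=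
      fun a s f => map_sum (zpowersHom ℂˣ a).toAdditiveRight f s
    rw [dotProduct, h, ← Finset.prod_pow]
    refine Finset.prod_congr rfl fun i _ => ?_
    rw [← zpow_natCast, ← zpow_natCast, ← _root_.zpow_mul, ← _root_.zpow_mul, ← _root_.zpow_mul]
    ring_nf
  rw [h]
  push_cast
  rfl

lemma norm_half_zpow (a : ℤ) : ‖(2⁻¹ : ℂ) ^ a‖ = (2⁻¹ : ℝ) ^ a := by
  simp

lemma tendsto_half_zpow_pow {a : ℤ} (ha : 0 < a) (c : ℂ) :
    Tendsto (fun j : ℕ => c * ((2⁻¹ : ℂ) ^ a) ^ j) atTop (𝓝 0) := by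
  have h : ‖(2⁻¹ : ℂ) ^ a‖ < 1 := by
    rw [norm_half_zpow]
    rw [_root_.inv_zpow]
    exact inv_lt_one_of_one_lt₀ ((one_lt_zpow_iff_right₀ (by norm_num)).2 ha)
  simpa using (tendsto_pow_atTop_nhds_zero_of_norm_lt_one h).const_mul c

/-- A convergent geometric sequence of ratio `2⁻ᵃ` has `a ≥ 0`. -/
lemma nonneg_of_tendsto_half_zpow_pow {a : ℤ} {c L : ℂ} (hc : c ≠ 0)
    (h : Tendsto (fun j : ℕ => c * ((2⁻¹ : ℂ) ^ a) ^ j) atTop (𝓝 L)) : 0 ≤ a := by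
  by_contra ha
  push Not at ha
  have h1 : (1 : ℝ) < (2⁻¹ : ℝ) ^ a := by
    rw [_root_.inv_zpow', one_lt_zpow_iff_right₀ (by norm_num)]
    linarith
  have h2 := (tendsto_pow_atTop_atTop_of_one_lt h1).const_mul_atTop (norm_pos_iff.2 hc)
  refine not_tendsto_nhds_of_tendsto_atTop h2 ‖L‖ (h.norm.congr fun j => ?_)
  rw [norm_mul, norm_pow, norm_half_zpow]

/-- If `v` is in the relative interior of the face `σ` of `τ`, then `λ_v(s) t` converges to
`t P_σ` in the chart `U_τ` as `s → 0`. -/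
lemma tendsto_torusChart_oneParam {n : ℕ} {σ τ : Cone n} (hle : σ ≤ τ) (t : Torus n)
    {v : Fin n → ℤ} (hv : latticeVec v ∈ σ)
    (hv0 : ∀ m ∈ dualMonoid σ, m ⬝ᵥ v = 0 → m ∈ perpLattice σ) (g : CoordRing τ) :
    Tendsto (fun j => torusChart τ (oneParam t v j) g) atTop
      (𝓝 (chartMap hle (orbitChart σ (toOrbitTorus σ t)) g)) := by
  induction g using AddMonoidAlgebra.induction_linear with
  | zero => simp
  | add f g hf hg => simpa only [map_add] using hf.add hg
  | single m r =>
    have hr : AddMonoidAlgebra.single m r = r • AddMonoidAlgebra.single m (1 : ℂ) := by simp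
    rw [hr]
    simp only [map_smul]
    refine Tendsto.const_smul ?_ r
    simp only [torusChart_single, chartMap_single, orbitChart_single, character_oneParam]
    have hm : (m : Fin n → ℤ) ∈ dualMonoid σ := dualMonoid_anti hle m.2
    split_ifs with h
    · have h0 : (m : Fin n → ℤ) ⬝ᵥ v = 0 := by
        have := h _ hv
        rw [pairing_latticeVec] at this
        exact_mod_cast this
      simp only [h0, zpow_zero, one_pow, mul_one]
      exact tendsto_const_nhds
    · refine tendsto_half_zpow_pow (lt_of_le_of_ne ?_ fun h0 => h (hv0 _ hm h0.symm)) _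
      have := hm _ hv
      rw [pairing_latticeVec] at this
      exact_mod_cast this

/-- A regular function on `U_τ ∖ {h = 0}` is continuous along a sequence of torus points that
converges to a point where `h ≠ 0`. -/
lemma tendsto_basicOpen {n : ℕ} {τ : Cone n} {h : CoordRing τ} {t : ℕ → Torus n} (x : BasicOpen h)
    (hx : ∀ g, Tendsto (fun j => torusChart τ (t j) g) atTop (𝓝 (x.toChart g))) :
    ∃ y : ℕ → BasicOpen h, (∀ᶠ j in atTop, (y j).toChart = torusChart τ (t j)) ∧
      ∀ g, Tendsto (fun j => y j g) atTop (𝓝 (x g)) := by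
  have hval : ∀ (y : BasicOpen h) a, y (algebraMap _ _ a) = y.toChart a := fun _ _ => rfl
  have hxh : x.toChart h ≠ 0 := by
    rw [← hval]
    exact ((IsLocalization.Away.algebraMap_isUnit h).map x).ne_zero
  have hex : ∀ j, ∃ y : BasicOpen h, torusChart τ (t j) h ≠ 0 → y.toChart = torusChart τ (t j) := by
    intro j
    by_cases hj : torusChart τ (t j) h ≠ 0
    · obtain ⟨y, hy⟩ := exists_toChart_eq hj
      exact ⟨y, fun _ => hy⟩
    · exact ⟨x, fun h => absurd h hj⟩
  choose y hy using hex
  have hne : ∀ᶠ j in atTop, torusChart τ (t j) h ≠ 0 := (hx h).eventually_ne hxh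
  refine ⟨y, hne.mono hy, fun g => ?_⟩
  obtain ⟨k, a, ha⟩ := IsLocalization.Away.surj h g
  have hg : ∀ y : BasicOpen h, y.toChart h ≠ 0 → y g = y.toChart a / y.toChart h ^ k := by
    intro y hy
    rw [eq_div_iff (pow_ne_zero _ hy), ← hval, ← hval, ← map_pow, ← map_mul, ha]
  rw [hg x hxh]
  refine ((hx a).div ((hx h).pow k) (pow_ne_zero _ hxh)).congr' ?_
  filter_upwards [hne] with j hj
  rw [hg (y j) (by rw [hy j hj]; exact hj), hy j hj]
  rfl

/-- The rational map `φ_A` is defined on the orbit `O_σ` only if `A` maps `σ` into a cone of the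
fan, and then it is given by the toric morphism.  The value of a morphism at a point of `O_σ` is a
limit of its values along one-parameter subgroups; that these limits exist is the condition on
`A`. -/
lemma MapsTo.exists_mapsCone {n : ℕ} {Δ : Fan n} {A : Matrix (Fin n) (Fin n) ℤ} {σ : Δ.cones}
    {z : OrbitTorus σ.1} {Q : Variety Δ} (hPQ : MapsTo Δ A (orbitPoint σ z) Q) :
    ∃ (τ : Δ.cones) (h : MapsCone A σ.1 τ.1),
      Q = toVariety τ (h.toricMap (orbitChart σ.1 z)) := by
  obtain ⟨t, rfl⟩ := toOrbitTorus_surjective σ.1 z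
  obtain ⟨V, f, hf, hP, rfl, htorus⟩ := hPQ
  obtain ⟨ρ, τ, h, F, ⟨x, hx⟩, hy⟩ := hf _ hP
  obtain ⟨hle, hx'⟩ := eq_chartMap_of_toVariety_eq hx
  have hfP := (hy x).2
  rw [hx] at hfP
  obtain ⟨v₀, hv₀, hv₀'⟩ := exists_relint (Δ.rational σ.1 σ.2)
  have hlim : ∀ v, latticeVec v ∈ σ.1 →
      (∀ m ∈ dualMonoid σ.1, m ⬝ᵥ v = 0 → m ∈ perpLattice σ.1) → ∀ m : dualMonoid τ.1,
      Tendsto (fun j : ℕ => (character t (Multiplicative.ofAdd ((m : Fin n → ℤ) ᵥ* A)) : ℂ) *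
        (2⁻¹ ^ (((m : Fin n → ℤ) ᵥ* A) ⬝ᵥ v)) ^ j) atTop
        (𝓝 (x (F (AddMonoidAlgebra.single m 1)))) := by
    intro v hv hv' m
    obtain ⟨y, hyt, hyx⟩ := tendsto_basicOpen (t := oneParam t v) x
      (by rw [hx']; exact tendsto_torusChart_oneParam hle t hv hv')
    refine (hyx (F (AddMonoidAlgebra.single m 1))).congr' ?_
    filter_upwards [hyt] with j hj
    obtain ⟨hV, hfy⟩ := hy (y j)
    rw [hj, ← torusPoint_eq] at hV hfy
    rw [htorus _ hV, torusPoint_eq τ] at hfy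
    have h1 := congrArg (fun x : Chart τ.1 => x (AddMonoidAlgebra.single m 1))
      (toVariety_injective τ hfy)
    simp only [torusChart_single, character_monomialMap, character_oneParam] at h1
    exact h1.symm
  have hcone : MapsCone A σ.1 τ.1 := by
    have hle : σ.1 ≤ PointedCone.comap (A.map (Int.cast : ℤ → ℝ)).mulVecLin τ.1 := by
      refine le_of_latticeVec (Δ.rational σ.1 σ.2) fun w hw => ?_
      have hAw : (A.map (Int.cast : ℤ → ℝ)).mulVecLin (latticeVec w) = latticeVec (A *ᵥ w) := by
        ext i
        simp [latticeVec, mulVec, dotProduct]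
      rw [PointedCone.mem_comap, hAw]
      refine latticeVec_mem_of_dual (Δ.rational τ.1 τ.2) fun m hm => ?_
      rw [dotProduct_mulVec]
      -- `v₀ + k w` is in the relative interior of `σ` for every `k`.
      have hk : ∀ k : ℕ, 0 ≤ (m ᵥ* A) ⬝ᵥ v₀ + k * ((m ᵥ* A) ⬝ᵥ w) := by
        intro k
        have hlv : latticeVec (k • w) = (k : NNReal) • latticeVec w := by
          ext i
          simp [latticeVec, NNReal.smul_def]
        have hdp : ∀ m : Fin n → ℤ, m ⬝ᵥ (v₀ + k • w) = m ⬝ᵥ v₀ + k * (m ⬝ᵥ w) := fun m => by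
          rw [dotProduct_add, dotProduct_smul, nsmul_eq_mul]
        rw [← hdp]
        refine nonneg_of_tendsto_half_zpow_pow (Units.ne_zero _)
          (hlim (v₀ + k • w) ?_ (fun m' hm' h0 => hv₀' m' hm' ?_) ⟨m, hm⟩)
        · rw [latticeVec_add, hlv]
          exact add_mem hv₀ (Submodule.smul_mem _ _ hw)
        · rw [hdp] at h0
          have h1 := hm' _ hv₀
          have h2 := hm' _ hw
          rw [pairing_latticeVec] at h1 h2
          have h1' : 0 ≤ m' ⬝ᵥ v₀ := by exact_mod_cast h1
          have h2' : 0 ≤ m' ⬝ᵥ w := by exact_mod_cast h2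
          have h3 : 0 ≤ (k : ℤ) * (m' ⬝ᵥ w) := mul_nonneg (Int.natCast_nonneg k) h2'
          linarith
      by_contra hneg
      push Not at hneg
      have h1 := hk (((m ᵥ* A) ⬝ᵥ v₀).toNat + 1)
      have h2 := Int.self_le_toNat ((m ᵥ* A) ⬝ᵥ v₀)
      push_cast at h1
      nlinarith [Int.natCast_nonneg ((m ᵥ* A) ⬝ᵥ v₀).toNat]
    exact fun v hv => hle hv
  refine ⟨τ, hcone, hfP.trans (congrArg _ (chart_ext fun m => ?_))⟩
  have h1 := hlim v₀ hv₀ hv₀' m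
  have h2 := tendsto_torusChart_oneParam le_rfl t hv₀ hv₀'
    (AddMonoidAlgebra.single ⟨(m : Fin n → ℤ) ᵥ* A, hcone.vecMul_mem_dualMonoid m.2⟩ 1)
  simp only [torusChart_single, character_oneParam] at h2
  rw [chartMap_refl] at h2
  rw [hcone.toricMap_single]
  exact tendsto_nhds_unique h1 h2

/-! ### The rational map on the orbits -/

/-- `A` maps `σ` into `τ`, and the relative interior of `σ` into that of `τ`; the latter is
expressed by means of the supporting forms of `τ`. -/
structure MapsRelint {n : ℕ} (A : Matrix (Fin n) (Fin n) ℤ) (σ τ : Cone n) : Prop where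
  mapsCone : MapsCone A σ τ
  mem_perpLattice : ∀ m ∈ dualMonoid τ, m ᵥ* A ∈ perpLattice σ → m ∈ perpLattice τ

/-- If `A` maps `σ` into `τ`, then it maps the relative interior of `σ` into that of a face of `τ`,
namely the one whose orbit contains the image of the distinguished point of `U_σ`. -/
lemma MapsCone.exists_mapsRelint {n : ℕ} {Δ : Fan n} {A : Matrix (Fin n) (Fin n) ℤ}
    {σ τ : Δ.cones} (h : MapsCone A σ.1 τ.1) :
    ∃ ρ : Δ.cones, ρ.1 ≤ τ.1 ∧ MapsRelint A σ.1 ρ.1 := by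
  obtain ⟨u, hu⟩ := exists_face_ne_zero_iff (Δ.rational τ.1 τ.2) (h.toricMap (orbitChart σ.1 1))
  have hu' : ∀ m ∈ dualMonoid τ.1,
      (m ᵥ* A ∈ perpLattice σ.1 ↔ m ∈ perpLattice (cutFace τ.1 u)) := by
    intro m hm
    rw [← hu ⟨m, hm⟩, h.toricMap_single, orbitChart_single]
    split_ifs with h0
    · simpa using h0
    · simpa using h0
  have hmem := Δ.face_mem _ τ.2 _ (isFace_cutFace u.2)
  have huA := (hu' u u.2).2 fun v hv => hv.2
  refine ⟨⟨_, hmem⟩, cutFace_le _ _, fun v hv => ⟨h v hv, ?_⟩, fun m hm hmA => ?_⟩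
  · rw [← pairing_vecMul]
    exact huA v hv
  · obtain ⟨k, hk⟩ := exists_add_nsmul_mem_dualMonoid (Δ.rational τ.1 τ.2) u.2
      (fun v hv h0 => hm v ⟨hv, h0⟩)
    have h1 := (hu' _ hk).1 (by
      rw [add_vecMul, smul_vecMul]
      exact add_mem hmA (nsmul_mem huA k))
    have h2 : k • (u : Fin n → ℤ) ∈ perpLattice (cutFace τ.1 u) := nsmul_mem (fun v hv => hv.2) k
    simpa using sub_mem h1 h2

lemma MapsRelint.toricMap_orbitChart {n : ℕ} {A : Matrix (Fin n) (Fin n) ℤ} {σ τ : Cone n}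
    (h : MapsRelint A σ τ) (t : Torus n) :
    h.mapsCone.toricMap (orbitChart σ (toOrbitTorus σ t)) =
      orbitChart τ (toOrbitTorus τ (monomialMap A t)) := by
  refine chart_ext fun m => ?_
  rw [h.mapsCone.toricMap_single, orbitChart_single, orbitChart_single]
  have hiff : (m : Fin n → ℤ) ᵥ* A ∈ perpLattice σ ↔ (m : Fin n → ℤ) ∈ perpLattice τ :=
    ⟨h.mem_perpLattice m m.2, h.mapsCone.vecMul_mem_perpLattice⟩
  split_ifs with h1 h2 h2
  · exact congrArg Units.val (character_monomialMap A t m).symm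
  · exact absurd (hiff.1 h1) h2
  · exact absurd (hiff.2 h2) h1
  · rfl

lemma MapsCone.toVariety_toricMap_eq {n : ℕ} {Δ : Fan n} {A : Matrix (Fin n) (Fin n) ℤ}
    {σ : Cone n} {τ τ' : Δ.cones} (h : MapsCone A σ τ.1) (h' : MapsCone A σ τ'.1) (x : Chart σ) :
    toVariety τ (h.toricMap x) = toVariety τ' (h'.toricMap x) := by
  have hinf : MapsCone A σ (τ.1 ⊓ τ'.1) := fun v hv => ⟨h v hv, h' v hv⟩
  refine Quot.sound ⟨hinf.toricMap x, ?_, ?_⟩ <;>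
  · refine chart_ext fun m => ?_
    rw [chartMap_single, toricMap_single, toricMap_single]

/-- On orbits, the rational map `φ_A` is induced by the endomorphism of the torus. -/
lemma MapsRelint.mapsTo_orbitPoint_iff {n : ℕ} {Δ : Fan n} {A : Matrix (Fin n) (Fin n) ℤ}
    {σ τ : Δ.cones} (h : MapsRelint A σ.1 τ.1) {t : Torus n} {Q : Variety Δ} :
    MapsTo Δ A (orbitPoint σ (toOrbitTorus σ.1 t)) Q ↔
      Q = orbitPoint τ (toOrbitTorus τ.1 (monomialMap A t)) := by
  have heq : toVariety τ (h.mapsCone.toricMap (orbitChart σ.1 (toOrbitTorus σ.1 t))) =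
      orbitPoint τ (toOrbitTorus τ.1 (monomialMap A t)) :=
    congrArg _ (h.toricMap_orbitChart t)
  constructor
  · intro hQ
    obtain ⟨τ', h', rfl⟩ := hQ.exists_mapsCone
    rw [← heq]
    exact h'.toVariety_toricMap_eq h.mapsCone _
  · rintro rfl
    rw [← heq]
    exact h.mapsCone.mapsTo _

/-! ### The fan of the well-defined locus -/

/-- The cones of `Δ` all of whose iterated images under `A` are contained in cones of `Δ`. -/
def survivingCones {n : ℕ} (Δ : Fan n) (A : Matrix (Fin n) (Fin n) ℤ) : Set (Cone n) :=
  {σ | ∃ c : ℕ → Δ.cones, (c 0).1 = σ ∧ ∀ k, MapsCone A (c k).1 (c (k + 1)).1}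

lemma survivingCones_subset {n : ℕ} (Δ : Fan n) (A : Matrix (Fin n) (Fin n) ℤ) :
    survivingCones Δ A ⊆ Δ.cones := by
  rintro _ ⟨c, rfl, _⟩
  exact (c 0).2

/-- The surviving cones form a fan: if the images of `σ` lie in cones of `Δ`, then so do those
of its faces. -/
def survivingFan {n : ℕ} (Δ : Fan n) (A : Matrix (Fin n) (Fin n) ℤ) : Fan n where
  cones := survivingCones Δ A
  finite := Δ.finite.subset (survivingCones_subset Δ A)
  rational σ hσ := Δ.rational σ (survivingCones_subset Δ A hσ)
  stronglyConvex σ hσ := Δ.stronglyConvex σ (survivingCones_subset Δ A hσ)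
  zero_mem := by
    refine ⟨fun _ => ⟨⊥, Δ.zero_mem⟩, rfl, fun _ v hv => ?_⟩
    rw [(Submodule.mem_bot _).1 hv, Matrix.mulVec_zero]
    exact zero_mem _
  face_mem := by
    rintro _ ⟨c, rfl, hc⟩ τ hτ
    have hle : τ ≤ (c 0).1 := fun v hv => by
      obtain ⟨u, -, hu⟩ := hτ
      exact ((hu v).1 hv).1
    refine ⟨fun k => Nat.casesOn k ⟨τ, Δ.face_mem _ (c 0).2 τ hτ⟩ fun k => c (k + 1), rfl, ?_⟩
    rintro (_ | k)
    · exact fun v hv => hc 0 v (hle hv)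
    · exact hc (k + 1)
  inter_face σ hσ σ' hσ' :=
    Δ.inter_face σ (survivingCones_subset Δ A hσ) σ' (survivingCones_subset Δ A hσ')

/-- The orbit `O_σ` of a surviving cone is mapped successively into the orbits of a sequence of
cones. -/
lemma exists_mapsRelint_sequence {n : ℕ} {Δ : Fan n} {A : Matrix (Fin n) (Fin n) ℤ}
    {σ : Δ.cones} (hσ : σ.1 ∈ survivingCones Δ A) :
    ∃ c : ℕ → Δ.cones, c 0 = σ ∧ ∀ k, MapsRelint A (c k).1 (c (k + 1)).1 := by
  obtain ⟨d, hd0, hd⟩ := hσ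
  have hstep : ∀ k (ρ : {ρ : Δ.cones // ρ.1 ≤ (d k).1}),
      ∃ ρ' : {ρ : Δ.cones // ρ.1 ≤ (d (k + 1)).1}, MapsRelint A ρ.1.1 ρ'.1.1 := by
    rintro k ⟨ρ, hρ⟩
    obtain ⟨ρ', hle, h⟩ := MapsCone.exists_mapsRelint (σ := ρ) (τ := d (k + 1))
      fun v hv => hd k v (hρ hv)
    exact ⟨⟨ρ', hle⟩, h⟩
  choose next hnext using hstep
  let c : ∀ k, {ρ : Δ.cones // ρ.1 ≤ (d k).1} :=
    fun k => Nat.rec ⟨σ, hd0.ge⟩ (fun k ρ => next k ρ) k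
  exact ⟨fun k => (c k).1, rfl, fun k => hnext k (c k)⟩

/-- The cone whose relative interior receives that of `σ` is unique. -/
lemma MapsRelint.eq {n : ℕ} {Δ : Fan n} {A : Matrix (Fin n) (Fin n) ℤ} {σ τ τ' : Δ.cones}
    (h : MapsRelint A σ.1 τ.1) (h' : MapsRelint A σ.1 τ'.1) : τ = τ' :=
  eq_of_orbitPoint_eq (h'.mapsTo_orbitPoint_iff.1 ((h.mapsTo_orbitPoint_iff (t := 1)).2 rfl))

/-- Forward orbits under `φ_A`, in terms of the endomorphism of the torus. -/
lemma isForwardOrbit_iff {n : ℕ} {Δ : Fan n} {A : Matrix (Fin n) (Fin n) ℤ} {c : ℕ → Δ.cones}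
    (hc : ∀ k, MapsRelint A (c k).1 (c (k + 1)).1) {t : Torus n} {o : ℕ → Variety Δ} :
    IsForwardOrbit Δ A (orbitPoint (c 0) (toOrbitTorus (c 0).1 t)) o ↔
      ∀ k, o k = orbitPoint (c k) (toOrbitTorus (c k).1 ((monomialMap A)^[k] t)) := by
  constructor
  · rintro ⟨h0, h⟩ k
    induction k with
    | zero => exact h0
    | succ k ih =>
      have := h k
      rw [ih, (hc k).mapsTo_orbitPoint_iff] at this
      rw [this, Function.iterate_succ_apply']
  · intro h
    refine ⟨h 0, fun k => ?_⟩
    rw [h k, (hc k).mapsTo_orbitPoint_iff, h (k + 1), Function.iterate_succ_apply']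

lemma wellDefinedLocus_eq {n : ℕ} (Δ : Fan n) (A : Matrix (Fin n) (Fin n) ℤ) :
    wellDefinedLocus Δ A = ⋃ σ ∈ {σ : Δ.cones | σ.1 ∈ (survivingFan Δ A).cones}, orbit σ := by
  ext P
  simp only [Set.mem_iUnion, Set.mem_ofPred_eq, exists_prop, ← range_orbitPoint]
  constructor
  · rintro ⟨o, rfl, ho⟩
    choose c z hcz using fun k => exists_eq_orbitPoint (o k)
    refine ⟨c 0, ⟨c, rfl, fun k => ?_⟩, z 0, (hcz 0).symm⟩
    have hk := ho k
    rw [hcz k] at hk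
    obtain ⟨τ, h, -⟩ := hk.exists_mapsCone
    obtain ⟨ρ, -, hρ⟩ := h.exists_mapsRelint
    obtain ⟨t, ht⟩ := toOrbitTorus_surjective (c k).1 (z k)
    rw [← ht, hρ.mapsTo_orbitPoint_iff, hcz (k + 1)] at hk
    rw [eq_of_orbitPoint_eq hk]
    exact hρ.mapsCone
  · rintro ⟨σ, hσ, z, rfl⟩
    obtain ⟨c, rfl, hc⟩ := exists_mapsRelint_sequence hσ
    obtain ⟨t, rfl⟩ := toOrbitTorus_surjective (c 0).1 z
    exact ⟨_, (isForwardOrbit_iff hc).2 fun k => rfl⟩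

/-! ### Preperiodic points of an orbit -/

lemma character_iterate {n : ℕ} (A : Matrix (Fin n) (Fin n) ℤ) (t : Torus n) (k : ℕ)
    (m : Fin n → ℤ) : character ((monomialMap A)^[k] t) (Multiplicative.ofAdd m) =
      character t (Multiplicative.ofAdd (m ᵥ* A ^ k)) := by
  induction k generalizing m with
  | zero => simp
  | succ k ih => rw [Function.iterate_succ_apply', character_monomialMap, ih, vecMul_vecMul,
      pow_succ']

lemma toOrbitTorus_eq_iff {n : ℕ} {σ : Cone n} {t t' : Torus n} :
    toOrbitTorus σ t = toOrbitTorus σ t' ↔ ∀ m ∈ perpLattice σ,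
      character t (Multiplicative.ofAdd m) = character t' (Multiplicative.ofAdd m) :=
  ⟨fun h m hm => DFunLike.congr_fun h (Multiplicative.ofAdd (⟨m, hm⟩ : perpLattice σ)),
    fun h => MonoidHom.ext fun m => h _ m.toAdd.2⟩

/-- The lattice of the characters `(Aᵀ)^{s+N} m - (Aᵀ)^s m`, for `m` in the character lattice of
the orbit reached after `s + N` steps.  The points of the first orbit with
`φ^{s+N}(P) = φ^s(P)` are those on which these characters are trivial, if the orbits reached after
`s + N` and after `s` steps agree. -/
def differenceLattice {n : ℕ} (A : Matrix (Fin n) (Fin n) ℤ) (c : ℕ → Cone n) (s N : ℕ) :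
    Submodule ℤ (Fin n → ℤ) :=
  (perpLattice (c (s + N))).toIntSubmodule.map (vecMulLinear (A ^ (s + N) - A ^ s))

lemma mem_differenceLattice {n : ℕ} {A : Matrix (Fin n) (Fin n) ℤ} {c : ℕ → Cone n} {s N : ℕ}
    {l : Fin n → ℤ} : l ∈ differenceLattice A c s N ↔
      ∃ m ∈ perpLattice (c (s + N)), m ᵥ* A ^ (s + N) - m ᵥ* A ^ s = l := by
  simp only [differenceLattice, Submodule.mem_map, Matrix.vecMulLinear_apply, Matrix.vecMul_sub]
  rfl

lemma vecMul_pow_mem_perpLattice {n : ℕ} {A : Matrix (Fin n) (Fin n) ℤ} {c : ℕ → Cone n}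
    (hc : ∀ k, MapsCone A (c k) (c (k + 1))) (i k : ℕ) {m : Fin n → ℤ}
    (hm : m ∈ perpLattice (c (i + k))) : m ᵥ* A ^ k ∈ perpLattice (c i) := by
  induction k generalizing m with
  | zero => simpa using hm
  | succ k ih =>
    rw [pow_succ', ← vecMul_vecMul]
    exact ih ((hc (i + k)).vecMul_mem_perpLattice hm)

/-- The difference lattice of a later and longer period is contained in that of the original
one. -/
lemma differenceLattice_le {n : ℕ} {A : Matrix (Fin n) (Fin n) ℤ} {c : ℕ → Cone n}
    (hc : ∀ k, MapsCone A (c k) (c (k + 1))) {s N : ℕ}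
    (hper : ∀ e K, c (s + e + K * N) = c (s + e)) (e K : ℕ) :
    differenceLattice A c (s + e) (K * N) ≤ differenceLattice A c s N := by
  intro l hl
  obtain ⟨m, hm, rfl⟩ := mem_differenceLattice.1 hl
  rw [hper] at hm
  clear hl
  induction K with
  | zero => simp
  | succ K ih =>
    have h1 : m ᵥ* A ^ (e + K * N) ∈ perpLattice (c (s + N)) := by
      have h2 := hper 0 1
      rw [add_zero, one_mul] at h2
      rw [h2]
      exact vecMul_pow_mem_perpLattice hc s _ (by rwa [← add_assoc, hper])
    -- The difference telescopes.
    have h2 : m ᵥ* A ^ (s + e + (K + 1) * N) - m ᵥ* A ^ (s + e) =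
        ((m ᵥ* A ^ (e + K * N)) ᵥ* A ^ (s + N) - (m ᵥ* A ^ (e + K * N)) ᵥ* A ^ s) +
          (m ᵥ* A ^ (s + e + K * N) - m ᵥ* A ^ (s + e)) := by
      rw [vecMul_vecMul, vecMul_vecMul, ← pow_add, ← pow_add,
        show e + K * N + (s + N) = s + e + (K + 1) * N by ring,
        show e + K * N + s = s + e + K * N by ring]
      abel
    rw [h2]
    exact add_mem (mem_differenceLattice.2 ⟨_, h1, rfl⟩) ih

/-- A sublattice of full rank contains a multiple of the lattice. -/
lemma exists_smul_mem_of_finrank_eq {n : ℕ} {L L' : Submodule ℤ (Fin n → ℤ)} (hle : L' ≤ L)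
    (h : Module.finrank ℤ L' = Module.finrank ℤ L) :
    ∃ k : ℕ, 1 ≤ k ∧ ∀ l ∈ L, k • l ∈ L' := by
  have hfin : Finite (L ⧸ L'.submoduleOf L) :=
    Submodule.finiteQuotientOfFreeOfRankEq _
      ((Submodule.submoduleOfEquivOfLe hle).finrank_eq.trans h)
  refine ⟨Nat.card (L ⧸ L'.submoduleOf L), Nat.card_pos, fun l hl => ?_⟩
  have h1 : Nat.card (L ⧸ L'.submoduleOf L) • (Submodule.Quotient.mk ⟨l, hl⟩ :
      L ⧸ L'.submoduleOf L) = 0 := card_nsmul_eq_zero'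
  rw [← Submodule.Quotient.mk_smul, Submodule.Quotient.mk_eq_zero] at h1
  exact h1

/-- The points of the torus `O_σ` at which all characters in `L ∩ σ^⊥` are trivial. -/
def annihilator {n : ℕ} (σ : Cone n) (L : Submodule ℤ (Fin n → ℤ)) : Subgroup (OrbitTorus σ) where
  carrier := {z | ∀ m : perpLattice σ, (m : Fin n → ℤ) ∈ L → z (Multiplicative.ofAdd m) = 1}
  one_mem' _ _ := rfl
  mul_mem' ha hb m hm := by rw [MonoidHom.mul_apply, ha m hm, hb m hm, one_mul]
  inv_mem' ha m hm := by rw [MonoidHom.inv_apply, ha m hm, inv_one]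

lemma isAlgebraicSubgroup_annihilator {n : ℕ} (σ : Cone n) (L : Submodule ℤ (Fin n → ℤ)) :
    IsAlgebraicSubgroup (annihilator σ L) := by
  refine ⟨{f | ∃ m : perpLattice σ, (m : Fin n → ℤ) ∈ L ∧ f = AddMonoidAlgebra.single m 1 - 1},
    fun z => ?_⟩
  have h : ∀ m : perpLattice σ, OrbitTorus.eval z (AddMonoidAlgebra.single m 1 - 1) = 0 ↔
      z (Multiplicative.ofAdd m) = 1 := by
    intro m
    rw [OrbitTorus.eval, map_sub, map_one, sub_eq_zero, ← Units.val_inj]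
    simp
  constructor
  · rintro hz _ ⟨m, hm, rfl⟩
    exact (h m).2 (hz m hm)
  · exact fun hz m hm => (h m).1 (hz _ ⟨m, hm, rfl⟩)

/-- Among infinitely many homomorphisms from `ℤⁿ` whose `k`-th powers agree on a subgroup, two
agree there: at each of finitely many generators they differ by `k`-th roots of unity. -/
lemma exists_lt_eqOn_of_pow_eq {n : ℕ} (H : AddSubgroup (Fin n → ℤ)) {k : ℕ} (hk : 1 ≤ k)
    (f : ℕ → Multiplicative (Fin n → ℤ) →* ℂˣ)
    (hf : ∀ j, ∀ m ∈ H, f j (Multiplicative.ofAdd m) ^ k = f 0 (Multiplicative.ofAdd m) ^ k) :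
    ∃ i j, i < j ∧ ∀ m ∈ H, f i (Multiplicative.ofAdd m) = f j (Multiplicative.ofAdd m) := by
  obtain ⟨S, hS⟩ := IsNoetherian.noetherian H.toIntSubmodule
  have hSH : ∀ m ∈ S, m ∈ H := fun m hm => by
    have : m ∈ H.toIntSubmodule := hS ▸ Submodule.subset_span hm
    exact this
  have : NeZero k := ⟨by omega⟩
  let g : ℕ → S → rootsOfUnity k ℂ := fun j m =>
    ⟨f j (Multiplicative.ofAdd m.1) / f 0 (Multiplicative.ofAdd m.1), by
      rw [mem_rootsOfUnity, div_pow, hf j _ (hSH _ m.2), div_self']⟩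
  have key : ∀ i j, g i = g j →
      ∀ m ∈ H, f i (Multiplicative.ofAdd m) = f j (Multiplicative.ofAdd m) := by
    intro i j hij m hm
    have hm' : m ∈ Submodule.span ℤ (S : Set (Fin n → ℤ)) := by rw [hS]; exact hm
    induction hm' using Submodule.span_induction with
    | mem m hmS => exact div_left_inj.1 (congrArg Subtype.val (congrFun hij ⟨m, hmS⟩))
    | zero => rw [ofAdd_zero, map_one, map_one]
    | add a b ha hb iha ihb =>
      rw [hS] at ha hb
      rw [ofAdd_add, map_mul, map_mul, iha ha, ihb hb]
    | smul r a ha iha =>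
      rw [hS] at ha
      rw [ofAdd_zsmul, map_zpow, map_zpow, iha ha]
  obtain ⟨i, j, hne, hij⟩ := Finite.exists_ne_map_eq_of_infinite g
  rcases hne.lt_or_gt with hlt | hlt
  · exact ⟨i, j, hlt, key i j hij⟩
  · exact ⟨j, i, hlt, key j i hij.symm⟩

/-- The points of an orbit that are preperiodic with given `s` and `r = s + N`. -/
lemma orbitPoint_iterate_eq_iff {n : ℕ} {Δ : Fan n} {A : Matrix (Fin n) (Fin n) ℤ}
    {c : ℕ → Δ.cones} {t : Torus n} {s N : ℕ} :
    orbitPoint (c (s + N)) (toOrbitTorus (c (s + N)).1 ((monomialMap A)^[s + N] t)) =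
        orbitPoint (c s) (toOrbitTorus (c s).1 ((monomialMap A)^[s] t)) ↔
      c (s + N) = c s ∧ ∀ l ∈ differenceLattice A (fun k => (c k).1) s N,
        character t (Multiplicative.ofAdd l) = 1 := by
  have h1 : (∀ l ∈ differenceLattice A (fun k => (c k).1) s N,
      character t (Multiplicative.ofAdd l) = 1) ↔
      toOrbitTorus (c (s + N)).1 ((monomialMap A)^[s + N] t) =
        toOrbitTorus (c (s + N)).1 ((monomialMap A)^[s] t) := by
    simp only [mem_differenceLattice, forall_exists_index, and_imp, forall_apply_eq_imp_iff₂,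
      toOrbitTorus_eq_iff, character_iterate, ofAdd_sub, map_div, div_eq_one]
  rw [h1]
  constructor
  · intro h
    have h2 := eq_of_orbitPoint_eq h
    rw [← h2] at h
    exact ⟨h2, orbitPoint_injective _ h⟩
  · rintro ⟨h2, h3⟩
    rw [h3, h2]

/-- The preperiodic points of an orbit `O_σ` form the divisible hull of an algebraic subgroup: the
subgroup defined by a difference lattice of minimal rank. -/
theorem exists_isAlgebraicSubgroup_prePer {n : ℕ} {Δ : Fan n} {A : Matrix (Fin n) (Fin n) ℤ}
    {c : ℕ → Δ.cones} (hc : ∀ k, MapsRelint A (c k).1 (c (k + 1)).1) :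
    ∃ G : Subgroup (OrbitTorus (c 0).1), IsAlgebraicSubgroup G ∧
      prePer Δ A ∩ orbit (c 0) = orbitPoint (c 0) '' divisibleHull G := by
  have hcone : ∀ k, MapsCone A (c k).1 (c (k + 1)).1 := fun k => (hc k).mapsCone
  have hshift : ∀ {i j : ℕ}, c i = c j → ∀ e, c (i + e) = c (j + e) := by
    intro i j h e
    induction e with
    | zero => exact h
    | succ e ih =>
      have h1 := hc (i + e)
      rw [ih] at h1
      exact h1.eq (hc (j + e))
  have hper : ∀ {s N : ℕ}, c (s + N) = c s → ∀ e K, c (s + e + K * N) = c (s + e) := by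
    intro s N h e K
    induction K with
    | zero => simp
    | succ K ih =>
      rw [← ih, show s + e + (K + 1) * N = s + N + (e + K * N) by ring,
        show s + e + K * N = s + (e + K * N) by ring]
      exact hshift h _
  let D : ℕ → ℕ → Submodule ℤ (Fin n → ℤ) := differenceLattice A fun k => (c k).1
  -- A preperiod `s` and period `N` of the sequence of cones with `D s N` of minimal rank.
  obtain ⟨s, N, hN, hsN, hmin⟩ : ∃ s N, 1 ≤ N ∧ c (s + N) = c s ∧ ∀ s' N', 1 ≤ N' →
      c (s' + N') = c s' → Module.finrank ℤ (D s N) ≤ Module.finrank ℤ (D s' N') := by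
    have hfin : Finite Δ.cones := Δ.finite
    obtain ⟨i, j, hij, hcij⟩ : ∃ i j, i < j ∧ c i = c j := by
      obtain ⟨i, j, hne, hij⟩ := Finite.exists_ne_map_eq_of_infinite c
      rcases hne.lt_or_gt with hlt | hlt
      · exact ⟨i, j, hlt, hij⟩
      · exact ⟨j, i, hlt, hij.symm⟩
    have hne : {p : ℕ × ℕ | 1 ≤ p.2 ∧ c (p.1 + p.2) = c p.1}.Nonempty :=
      ⟨(i, j - i), by omega, by rw [Nat.add_sub_cancel' hij.le, hcij]⟩
    let rk : ℕ × ℕ → ℕ := fun p => Module.finrank ℤ (D p.1 p.2)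
    refine ⟨(Function.argminOn rk _ hne).1, (Function.argminOn rk _ hne).2,
      (Function.argminOn_mem rk _ hne).1, (Function.argminOn_mem rk _ hne).2,
      fun s' N' hN' h' => ?_⟩
    exact Function.argminOn_le rk {p : ℕ × ℕ | 1 ≤ p.2 ∧ c (p.1 + p.2) = c p.1}
      (a := (s', N')) ⟨hN', h'⟩
  have hcomm : ∀ s' N', 1 ≤ N' → c (s' + N') = c s' →
      ∃ k : ℕ, 1 ≤ k ∧ ∀ l ∈ D s N, k • l ∈ D s' N' := by
    intro s' N' hN' h'
    -- A common refinement of the two periods.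
    have h1 : D (s + s') (N' * N) ≤ D s N :=
      differenceLattice_le hcone (fun e K => congrArg Subtype.val (hper hsN e K)) s' N'
    have h2 : D (s + s') (N' * N) ≤ D s' N' := by
      rw [add_comm s, mul_comm]
      exact differenceLattice_le hcone (fun e K => congrArg Subtype.val (hper h' e K)) s N
    obtain ⟨k, hk, hkl⟩ := exists_smul_mem_of_finrank_eq h1
      (le_antisymm (Submodule.finrank_mono h1)
        (hmin _ _ (Nat.mul_pos hN' hN) (hper hsN s' N')))
    exact ⟨k, hk, fun l hl => h2 (hkl l hl)⟩
  have hDperp : ∀ l ∈ D s N, l ∈ perpLattice (c 0).1 := by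
    intro l hl
    obtain ⟨m, hm, rfl⟩ := mem_differenceLattice.1 hl
    refine sub_mem (vecMul_pow_mem_perpLattice hcone 0 (s + N) (by rwa [zero_add]))
      (vecMul_pow_mem_perpLattice hcone 0 s ?_)
    rw [zero_add, ← hsN]
    exact hm
  have hann : ∀ t : Torus n, ∀ k : ℕ, toOrbitTorus (c 0).1 t ^ k ∈ annihilator (c 0).1 (D s N) ↔
      ∀ l ∈ D s N, character t (Multiplicative.ofAdd l) ^ k = 1 := fun t k =>
    ⟨fun h l hl => h ⟨l, hDperp l hl⟩ hl, fun h m hm => h m hm⟩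
  refine ⟨annihilator (c 0).1 (D s N), isAlgebraicSubgroup_annihilator _ _, ?_⟩
  rw [← range_orbitPoint]
  ext P
  constructor
  · rintro ⟨⟨o, ho, r', s', hlt, hrs⟩, z, rfl⟩
    obtain ⟨t, rfl⟩ := toOrbitTorus_surjective (c 0).1 z
    rw [isForwardOrbit_iff hc] at ho
    obtain ⟨N', rfl⟩ := Nat.exists_eq_add_of_lt hlt
    rw [add_assoc, ho, ho, orbitPoint_iterate_eq_iff] at hrs
    obtain ⟨k, hk, hkl⟩ := hcomm s' (N' + 1) (by omega) hrs.1
    refine ⟨_, ⟨k, hk, (hann t k).2 fun l hl => ?_⟩, rfl⟩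
    rw [← map_pow, ← ofAdd_nsmul]
    exact hrs.2 _ (hkl l hl)
  · rintro ⟨z, ⟨k, hk, hz⟩, rfl⟩
    obtain ⟨t, rfl⟩ := toOrbitTorus_surjective (c 0).1 z
    rw [hann] at hz
    refine ⟨⟨_, (isForwardOrbit_iff hc).2 fun k => rfl, ?_⟩, _, rfl⟩
    -- The `k`-th powers of the points reached after `s, s + N, s + 2N, …` steps agree.
    have hpow : ∀ j : ℕ, ∀ m ∈ perpLattice (c s).1,
        character ((monomialMap A)^[s + j * N] t) (Multiplicative.ofAdd m) ^ k =
          character ((monomialMap A)^[s + 0 * N] t) (Multiplicative.ofAdd m) ^ k := by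
      intro j m hm
      induction j with
      | zero => rfl
      | succ j ih =>
        rw [← ih, character_iterate, character_iterate, ← div_eq_one, ← div_pow, ← map_div,
          ← ofAdd_sub]
        refine hz _ (mem_differenceLattice.2 ⟨m ᵥ* A ^ (j * N), ?_, ?_⟩)
        · rw [hsN]
          refine vecMul_pow_mem_perpLattice hcone s (j * N) ?_
          have := hper hsN 0 j
          rw [add_zero] at this
          rwa [this]
        · rw [vecMul_vecMul, vecMul_vecMul, ← pow_add, ← pow_add,
            show j * N + (s + N) = s + (j + 1) * N by ring, add_comm (j * N)]
    obtain ⟨i, j, hij, hfij⟩ := exists_lt_eqOn_of_pow_eq (perpLattice (c s).1) hk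
      (fun j => character ((monomialMap A)^[s + j * N] t)) hpow
    have hcs : ∀ j, c (s + j * N) = c s := hper hsN 0
    refine ⟨s + j * N, s + i * N, by gcongr, ?_⟩
    rw [hcs, hcs]
    exact congrArg _ (toOrbitTorus_eq_iff.2 fun m hm => (hfij m hm).symm)

end Toric

end

theorem mainTheorem7 {n : ℕ} (Δ : Toric.Fan n) (A : Matrix (Fin n) (Fin n) ℤ) :
    ∃ Δ' : Toric.Fan n, Δ'.cones ⊆ Δ.cones ∧
      Toric.wellDefinedLocus Δ A = ⋃ σ ∈ {σ : Δ.cones | σ.1 ∈ Δ'.cones}, Toric.orbit σ ∧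
      {σ : Δ.cones | σ.1 ∈ Δ'.cones}.PairwiseDisjoint Toric.orbit ∧
      ∃ G : (σ : Δ.cones) → Subgroup (Toric.OrbitTorus σ.1),
        (∀ σ ∈ {σ : Δ.cones | σ.1 ∈ Δ'.cones},
          Toric.IsAlgebraicSubgroup (G σ) ∧
          Toric.prePer Δ A ∩ Toric.orbit σ = Toric.orbitPoint σ '' Toric.divisibleHull (G σ)) ∧
        Toric.prePer Δ A = ⋃ σ ∈ {σ : Δ.cones | σ.1 ∈ Δ'.cones},
          Toric.orbitPoint σ '' Toric.divisibleHull (G σ) := by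
  have hG : ∀ σ : Δ.cones, ∃ G : Subgroup (Toric.OrbitTorus σ.1),
      σ.1 ∈ (Toric.survivingFan Δ A).cones → Toric.IsAlgebraicSubgroup G ∧
        Toric.prePer Δ A ∩ Toric.orbit σ = Toric.orbitPoint σ '' Toric.divisibleHull G := by
    intro σ
    by_cases hσ : σ.1 ∈ (Toric.survivingFan Δ A).cones
    · obtain ⟨c, rfl, hc⟩ := Toric.exists_mapsRelint_sequence hσ
      obtain ⟨G, hG⟩ := Toric.exists_isAlgebraicSubgroup_prePer hc
      exact ⟨G, fun _ => hG⟩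
    · exact ⟨⊤, fun h => absurd h hσ⟩
  choose G hG using hG
  refine ⟨Toric.survivingFan Δ A, Toric.survivingCones_subset Δ A,
    Toric.wellDefinedLocus_eq Δ A, fun σ _ σ' _ h => Toric.disjoint_orbit h, G, hG, ?_⟩
  have hsub : Toric.prePer Δ A ⊆ Toric.wellDefinedLocus Δ A := fun P ⟨o, ho, _⟩ => ⟨o, ho⟩
  rw [← Set.inter_eq_left.2 hsub, Toric.wellDefinedLocus_eq, Set.inter_iUnion₂]
  exact Set.iUnion₂_congr fun σ hσ => (hG σ hσ).2
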